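/- Let $P,Q$ be real functions analytic at the origin of $\mathbb R^2$ and $\mathcal X=P\,\partial_x+Q\,\partial_y$. Write $P=\sum a_{ij}x^iy^{j-1}$, $Q=\sum b_{ij}x^{i-1}y^j$, let $\operatorname{supp}(\mathcal X)=\{(i,j):(a_{ij},b_{ij})\ne(0,0)\}$, and let $W(\mathbf N(\mathcal X))$ be the set of pairs $(p,q)$ of coprime positive integers such that the convex hull of $\bigcup_{(i,j)\in\operatorname{supp}(\mathcal X)}\{(i,j)+\mathbb R_+^2\}$ has a bounded edge in the direction $(q,-p)$. For $(p,q)\in W(\mathbf N(\mathcal X))$, a subscript $j$ on a function denotes its $(p,q)$-quasihomogeneous part of degree $j$ (the sum of its Taylor monomials $cx^iy^k$ at the origin with $pi+qk=j$), and $\mathcal X_j=P_{p+j}\partial_x+Q_{q+j}\partial_y$. Suppose that $\mathcal X=\mathcal X_r+\cdots$, with $r\ge1$ and $\mathcal X_r\not\equiv0$ its lowest-degree part, belongs to the class $\mathrm{Mo}^{(p,q)}$, that is, the origin is a monodromic singularity of $\mathcal X_r$: it is a singular point, and the orbit of every nonzero point close enough to the origin makes a full turn around the origin inside any prescribed neighbourhood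 of it. Let $F$ be analytic at the origin, $F\not\equiv0$ near the origin, $F(0,0)=0$, and let $F=0$ be invariant with cofactor $K$: $K$ is analytic at the origin and $P\,\partial_xF+Q\,\partial_yF=KF$ near the origin. Let $\bar r\ge0$ be such that $K_j\equiv0$ for all $j<\bar r$, so that $K=K_{\bar r}+K_{\bar r+1}+\cdots$. Put $D(\varphi)=p\cos^2\varphi+q\sin^2\varphi$, $$F_j(\varphi)=P_{p+j}(\cos\varphi,\sin\varphi)\cos\varphi+Q_{q+j}(\cos\varphi,\sin\varphi)\sin\varphi,$$ $$G_j(\varphi)=p\,Q_{q+j}(\cos\varphi,\sin\varphi)\cos\varphi-q\,P_{p+j}(\cos\varphi,\sin\varphi)\sin\varphi,$$ $$R(\varphi,\rho)=\sum_{j\ge r}\rho^{j-r+1}F_j(\varphi),\qquad \Theta(\varphi,\rho)=\sum_{j\ge r}\rho^{j-r}G_j(\varphi),\qquad \hat K(\varphi,\rho)=\frac{D(\varphi)K(\rho^p\cos\varphi,\rho^q\sin\varphi)}{\rho^r\,\Theta(\varphi,\rho)} .$$ (Here $F_j(\varphi)$ is built from $P,Q$ and not from the function $F$.) If $K_{\bar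 r}\not\equiv0$, then $\bar r\ge r$. Whenever $\bar r\ge r$, the following holds. The function $G_r$ has no zero. For all sufficiently small $\rho_0>0$ the Cauchy problem $d\rho/d\varphi=R(\varphi,\rho)/\Theta(\varphi,\rho)$, $\rho(0;\rho_0)=\rho_0$, has exactly one positive solution $\rho(\varphi;\rho_0)$ on $[0,2\pi]$ along which $\Theta$ does not vanish; it has a convergent expansion $\rho(\varphi;\rho_0)=\sum_{i\ge1}a_i(\varphi)\rho_0^i$, where $$a_1(\varphi)=\exp\left(\int_0^\varphi\frac{F_r(\theta)}{G_r(\theta)}\,d\theta\right)$$ and $a_2$ is continuous on $[0,2\pi]$; the function $\varphi\mapsto\hat K(\varphi,\rho(\varphi;\rho_0))$ is continuous on $[0,2\pi]$; there is a convergent expansion $$\int_0^{2\pi}\hat K(\varphi,\rho(\varphi;\rho_0))\,d\varphi=\sum_{i\ge\bar r-r}\beta_i\,\rho_0^i ;$$ and its first two coefficients are $$\beta_{\bar r-r}=\int_0^{2\pi}\frac{D(\varphi)\,a_1^{\bar r-r}(\varphi)\,K_{\bar r}(\cos\varphi,\sin\varphi)}{G_r(\varphi)}\,d\varphi,$$ $$\beta_{\bar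 r-r+1}=\int_0^{2\pi}D(\varphi)\left(\frac{(\bar r-r)\,a_1^{\bar r-r-1}(\varphi)\,a_2(\varphi)\,K_{\bar r}(\cos\varphi,\sin\varphi)}{G_r(\varphi)}+\frac{a_1^{\bar r-r+1}(\varphi)\big(K_{\bar r+1}(\cos\varphi,\sin\varphi)G_r(\varphi)-K_{\bar r}(\cos\varphi,\sin\varphi)G_{r+1}(\varphi)\big)}{G_r^2(\varphi)}\right)d\varphi .$$ -/

import Mathlib

open Real Set Filter Topology

noncomputable section

/-- The Taylor coefficient of `x ^ i * y ^ k` of `f` at the origin,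
`(∂ₓ ^ i ∂ᵧ ^ k f)(0, 0) / (i! k!)`. -/
def taylorCoeff (f : ℝ × ℝ → ℝ) (i k : ℕ) : ℝ :=
  iteratedFDeriv ℝ (i + k) f 0
      (fun n : Fin (i + k) => if (n : ℕ) < i then ((1 : ℝ), (0 : ℝ)) else ((0 : ℝ), (1 : ℝ))) /
    ((i.factorial : ℝ) * (k.factorial : ℝ))

/-- The `(p, q)`-quasihomogeneous part of degree `j` of `f` (for `p, q ≥ 1`): the sum of the Taylor
monomials `c x ^ i y ^ k` of `f` at the origin with `p i + q k = j`. -/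
def qhPart (p q : ℕ) (f : ℝ × ℝ → ℝ) (j : ℕ) (z : ℝ × ℝ) : ℝ :=
  ∑ m ∈ (Finset.range (j + 1) ×ˢ Finset.range (j + 1)).filter (fun m => p * m.1 + q * m.2 = j),
    taylorCoeff f m.1 m.2 * z.1 ^ m.1 * z.2 ^ m.2

/-- The support of the planar vector field `P ∂ₓ + Q ∂ᵧ`, where
`P = ∑ a i j * x ^ i * y ^ (j - 1)` and `Q = ∑ b i j * x ^ (i - 1) * y ^ j`: the set of the
`(i, j)` with `(a i j, b i j) ≠ (0, 0)`. -/
def fieldSupport (P Q : ℝ × ℝ → ℝ) : Set (ℕ × ℕ) :=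
  {m | (1 ≤ m.2 ∧ taylorCoeff P m.1 (m.2 - 1) ≠ 0) ∨
    (1 ≤ m.1 ∧ taylorCoeff Q (m.1 - 1) m.2 ≠ 0)}

/-- The convex hull of the union of the translated quadrants `(i, j) + ℝ₊²`, over the points
`(i, j)` of the support of the vector field. -/
def newtonRegion (P Q : ℝ × ℝ → ℝ) : Set (ℝ × ℝ) :=
  convexHull ℝ (⋃ m ∈ fieldSupport P Q, {z : ℝ × ℝ | (m.1 : ℝ) ≤ z.1 ∧ (m.2 : ℝ) ≤ z.2})

/-- `(p, q)` belongs to the weights of the Newton diagram of `P ∂ₓ + Q ∂ᵧ`: the positive integers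
`p, q` are coprime and the region has a bounded edge in the direction `(q, -p)` (the tangent of the
angle between this edge and the ordinate axis is `q / p`), that is, its face on which
`p i + q j` is minimal is more than a vertex. -/
def IsNewtonWeight (p q : ℕ) (P Q : ℝ × ℝ → ℝ) : Prop :=
  0 < p ∧ 0 < q ∧ Nat.Coprime p q ∧
    {z ∈ newtonRegion P Q | ∀ w ∈ newtonRegion P Q,
      (p : ℝ) * z.1 + (q : ℝ) * z.2 ≤ (p : ℝ) * w.1 + (q : ℝ) * w.2}.Nontrivial

/-- The origin is a monodromic singularity of the planar vector field `V`: it is a singular point,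
and the orbits near it turn around it. The orbit of every nonzero point that is close enough to
the origin makes a full turn around the origin (its continuous polar angle `θ` changes by `2π`)
inside any prescribed neighbourhood `U` of the origin. -/
def IsMonodromic (V : ℝ × ℝ → ℝ × ℝ) : Prop :=
  V 0 = 0 ∧ ∀ U ∈ 𝓝 (0 : ℝ × ℝ), ∃ W ∈ 𝓝 (0 : ℝ × ℝ), ∀ z ∈ W, z ≠ 0 →
    ∃ T : ℝ, 0 < T ∧ ∃ (γ : ℝ → ℝ × ℝ) (d θ : ℝ → ℝ),
      γ 0 = z ∧
      (∀ t ∈ Icc 0 T, γ t ∈ U ∧ HasDerivWithinAt γ (V (γ t)) (Icc 0 T) t ∧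
        0 < d t ∧ γ t = (d t * cos (θ t), d t * sin (θ t))) ∧
      ContinuousOn θ (Icc 0 T) ∧ |θ T - θ 0| = 2 * π

/-- The `(p, q)`-quasihomogeneous part `P_{p+j} ∂ₓ + Q_{q+j} ∂ᵧ` of degree `j` of the vector
field `P ∂ₓ + Q ∂ᵧ`. -/
def qhField (p q : ℕ) (P Q : ℝ × ℝ → ℝ) (j : ℕ) (z : ℝ × ℝ) : ℝ × ℝ :=
  (qhPart p q P (p + j) z, qhPart p q Q (q + j) z)

/-- The `(p, q)`-quasihomogeneous expansion of `P ∂ₓ + Q ∂ᵧ` starts with a nonzero part of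
degree `r`. -/
def HasLeadingDegree (p q : ℕ) (P Q : ℝ × ℝ → ℝ) (r : ℕ) : Prop :=
  (∀ m < p + r, ∀ z, qhPart p q P m z = 0) ∧ (∀ m < q + r, ∀ z, qhPart p q Q m z = 0) ∧
    ∃ z, qhField p q P Q r z ≠ 0

/-- The monodromic class `Mo^{(p,q)}`, with `r` the degree of the leading part: `(p, q)` is a weight
of the Newton diagram, and the leading part has a monodromic singularity at the origin. -/
def InMonodromicClass (p q : ℕ) (P Q : ℝ × ℝ → ℝ) (r : ℕ) : Prop :=
  IsNewtonWeight p q P Q ∧ HasLeadingDegree p q P Q r ∧ IsMonodromic (qhField p q P Q r)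

/-- `F_j(φ) = P_{p+j}(cos φ, sin φ) cos φ + Q_{q+j}(cos φ, sin φ) sin φ`. -/
def polarF (p q : ℕ) (P Q : ℝ × ℝ → ℝ) (j : ℕ) (φ : ℝ) : ℝ :=
  qhPart p q P (p + j) (cos φ, sin φ) * cos φ + qhPart p q Q (q + j) (cos φ, sin φ) * sin φ

/-- `G_j(φ) = p Q_{q+j}(cos φ, sin φ) cos φ - q P_{p+j}(cos φ, sin φ) sin φ`. -/
def polarG (p q : ℕ) (P Q : ℝ × ℝ → ℝ) (j : ℕ) (φ : ℝ) : ℝ :=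
  (p : ℝ) * qhPart p q Q (q + j) (cos φ, sin φ) * cos φ -
    (q : ℝ) * qhPart p q P (p + j) (cos φ, sin φ) * sin φ

/-- `D(φ) = p cos² φ + q sin² φ`. -/
def polarD (p q : ℕ) (φ : ℝ) : ℝ := (p : ℝ) * cos φ ^ 2 + (q : ℝ) * sin φ ^ 2

/-- `R(φ, ρ) = ∑_{j ≥ r} ρ^{j-r+1} F_j(φ)`. -/
def polarR (p q : ℕ) (P Q : ℝ × ℝ → ℝ) (r : ℕ) (φ ρ : ℝ) : ℝ :=
  ∑' j : ℕ, ρ ^ (j + 1) * polarF p q P Q (r + j) φ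

/-- `Θ(φ, ρ) = ∑_{j ≥ r} ρ^{j-r} G_j(φ)`. -/
def polarTheta (p q : ℕ) (P Q : ℝ × ℝ → ℝ) (r : ℕ) (φ ρ : ℝ) : ℝ :=
  ∑' j : ℕ, ρ ^ j * polarG p q P Q (r + j) φ

/-- The function `u`, on `[0, 2π]`, is a positive solution of the Cauchy problem
`dρ/dφ = R(φ, ρ) / Θ(φ, ρ)`, `ρ(0) = ρ₀`, along which `Θ` does not vanish. -/
def IsPolarSolution (p q : ℕ) (P Q : ℝ × ℝ → ℝ) (r : ℕ) (ρ₀ : ℝ) (u : ℝ → ℝ) : Prop :=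
  u 0 = ρ₀ ∧ ∀ φ ∈ Icc 0 (2 * π), 0 < u φ ∧ polarTheta p q P Q r φ (u φ) ≠ 0 ∧
    HasDerivWithinAt u (polarR p q P Q r φ (u φ) / polarTheta p q P Q r φ (u φ))
      (Icc 0 (2 * π)) φ

/-- The cofactor in weighted polar coordinates,
`K̂(φ, ρ) = D(φ) K(ρ^p cos φ, ρ^q sin φ) / (ρ^r Θ(φ, ρ))`. -/
def polarCofactor (p q : ℕ) (P Q : ℝ × ℝ → ℝ) (r : ℕ) (K : ℝ × ℝ → ℝ) (φ ρ : ℝ) : ℝ :=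
  polarD p q φ * K (ρ ^ p * cos φ, ρ ^ q * sin φ) / (ρ ^ r * polarTheta p q P Q r φ ρ)

end

noncomputable section

/-! The inequality `r ≤ rbar` compares weighted orders. Let `F_s` be the lowest part of `F`. Along a
curve `(l ^ p * x, l ^ q * y)` the left side of the invariance identity is `O(l ^ (r + s))`, while
`K F` has coefficient `K_rbar F_s` at order `rbar + s`. If `rbar < r`, then `K_rbar F_s` vanishes
identically, and so does `F_s` by the identity theorem, which is absurd
(`leadingDegree_le_of_cofactor`).

If `G_r(φ) = 0`, the weighted curve through the direction `φ` is invariant under the leading field.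
An orbit starting on it keeps the signs of both coordinates, so it cannot make the half turn
contained in a full turn (`polarG_ne_zero_of_isMonodromic`).

For the expansions, the unknown is the whole function `ρ(·; ρ₀)`, an element of the Banach algebra
`C([0, 2π])`. There `u ↦ ∑ F_j u ^ j / ∑ G_j u ^ j` is analytic at `0`, because `G_r` is a unit and
the coefficients grow at most geometrically. Variation of constants turns the Cauchy problem into
`N(u) = ρ₀ a₁`, where `N` is analytic with derivative the identity at `0`; the analytic inverse
function theorem yields a solution analytic in `ρ₀` (`exists_analytic_solution`,
`exists_analytic_ode_solution`). Its Taylor coefficients at `ρ₀ = 0` are the functions `a_i`, so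
they are continuous in `φ`.

Writing `ρ = ρ₀ v(ρ₀)` with `v(0) = a₁` and `v'(0) = a₂`, the cofactor becomes `ρ₀ ^ (rbar - r)`
times a curve `w(ρ₀)` analytic in the algebra. Integration is a continuous linear functional, so the
first two coefficients are the integrals of `w(0)` and `w'(0)` (`polar_expansion`). -/

/-! ### Taylor coefficients and quasihomogeneous parts of analytic functions. -/

/-- By symmetry of the iterated derivative, only the number of slots filled with `e₁` matters: a
permutation carries the initial segment onto `s`. -/
theorem iteratedFDeriv_piecewise_eq {f : ℝ × ℝ → ℝ} (hf : AnalyticAt ℝ f 0) (n : ℕ)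
    (s : Finset (Fin n)) (e₁ e₂ : ℝ × ℝ) :
    iteratedFDeriv ℝ n f 0 (s.piecewise (fun _ => e₁) (fun _ => e₂)) =
      iteratedFDeriv ℝ n f 0 (fun m : Fin n => if (m : ℕ) < s.card then e₁ else e₂) := by
  classical
  have hcard : Fintype.card {m : Fin n // (m : ℕ) < s.card} = Fintype.card {m : Fin n // m ∈ s} := by
    have hs : s.card ≤ n := by simpa using s.card_le_univ
    rw [Fintype.card_coe, Fintype.card_subtype]
    have : (Finset.univ.filter fun m : Fin n => (m : ℕ) < s.card).card = min n s.card := Fin.card_filter_val_lt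
    omega
  let e := Fintype.equivOfCardEq hcard
  rw [← hf.contDiffAt.iteratedFDeriv_comp_perm _ e.extendSubtype]
  congr 1
  ext1 m
  by_cases hm : (m : ℕ) < s.card
  · have := e.extendSubtype_mem m hm
    simp [Finset.piecewise, hm, this]
  · have := e.extendSubtype_not_mem m hm
    simp [Finset.piecewise, hm, this]

/-- Multilinear expansion in the two coordinate vectors gives one term per subset of slots. Grouping
by cardinality produces binomial coefficients, which turn `1 / n!` into `1 / (i! k!)`. -/
theorem iteratedFDeriv_const_apply {f : ℝ × ℝ → ℝ} (hf : AnalyticAt ℝ f 0) (n : ℕ)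
    (z : ℝ × ℝ) :
    ((n.factorial : ℝ))⁻¹ * iteratedFDeriv ℝ n f 0 (fun _ => z) =
      ∑ m ∈ Finset.HasAntidiagonal.antidiagonal n, taylorCoeff f m.1 m.2 * z.1 ^ m.1 * z.2 ^ m.2 := by
  classical
  have hz : (fun _ : Fin n => z) = (fun _ => z.1 • ((1 : ℝ), (0 : ℝ))) +
      (fun _ => z.2 • ((0 : ℝ), (1 : ℝ))) := by
    ext1 m; ext <;> simp
  rw [hz]
  have h1 := (iteratedFDeriv ℝ n f 0).toMultilinearMap.map_add_univ
    (fun _ : Fin n => z.1 • ((1 : ℝ), (0 : ℝ))) (fun _ => z.2 • ((0 : ℝ), (1 : ℝ)))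
  simp only [ContinuousMultilinearMap.coe_coe] at h1
  rw [h1]
  have h2 : ∀ s : Finset (Fin n), iteratedFDeriv ℝ n f 0
      (s.piecewise (fun _ => z.1 • ((1 : ℝ), (0 : ℝ))) (fun _ => z.2 • ((0 : ℝ), (1 : ℝ)))) =
      z.1 ^ s.card * z.2 ^ (n - s.card) * iteratedFDeriv ℝ n f 0
        (fun m : Fin n => if (m : ℕ) < s.card then ((1 : ℝ), (0 : ℝ)) else ((0 : ℝ), (1 : ℝ))) := by
    intro s
    rw [← iteratedFDeriv_piecewise_eq hf]
    have : s.piecewise (fun _ => z.1 • ((1 : ℝ), (0 : ℝ))) (fun _ => z.2 • ((0 : ℝ), (1 : ℝ))) =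
        fun i => (s.piecewise (fun _ => z.1) (fun _ => z.2) i : ℝ) •
          (s.piecewise (fun _ => ((1 : ℝ), (0 : ℝ))) (fun _ => ((0 : ℝ), (1 : ℝ))) i) := by
      ext1 i
      by_cases hi : i ∈ s <;> simp [hi]
    rw [this, ContinuousMultilinearMap.map_smul_univ]
    congr 1
    rw [Finset.prod_piecewise]
    simp [Finset.card_sdiff]
  simp_rw [h2]
  rw [← Finset.powerset_univ, Finset.sum_powerset_apply_card (fun k => z.1 ^ k * z.2 ^ (n - k) *
    iteratedFDeriv ℝ n f 0
        (fun m : Fin n => if (m : ℕ) < k then ((1 : ℝ), (0 : ℝ)) else ((0 : ℝ), (1 : ℝ)))),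
    Finset.Nat.sum_antidiagonal_eq_sum_range_succ_mk, Finset.mul_sum]
  simp only [Finset.card_univ, Fintype.card_fin]
  refine Finset.sum_congr rfl fun k hk => ?_
  have hk' : k ≤ n := by simpa [Nat.lt_succ_iff] using hk
  obtain ⟨l, rfl⟩ := Nat.exists_eq_add_of_le hk'
  have h3 := Nat.add_choose_mul_factorial_mul_factorial k l
  rw [← Nat.choose_symm_add] at h3
  have h4 : ((k + l).choose k : ℝ) * k.factorial * l.factorial = (k + l).factorial := by
    exact_mod_cast h3
  simp only [Nat.add_sub_cancel_left]
  rw [taylorCoeff, nsmul_eq_mul]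
  have := Nat.factorial_pos k
  have := Nat.factorial_pos l
  have := Nat.factorial_pos (k + l)
  rw [← h4]
  have h5 : ((k + l).choose k : ℝ) ≠ 0 := by
    exact_mod_cast (Nat.choose_pos hk').ne'
  field_simp

theorem exists_abs_taylorCoeff_le {f : ℝ × ℝ → ℝ} (hf : AnalyticAt ℝ f 0) :
    ∃ C M : ℝ, 0 < C ∧ 1 ≤ M ∧ ∀ i k, |taylorCoeff f i k| ≤ C * M ^ (i + k) := by
  obtain ⟨s, R, hs⟩ := hf
  obtain ⟨C, r, hC, hr, hCr⟩ := s.le_mul_pow_of_radius_pos (hs.r_pos.trans_le hs.r_le)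
  refine ⟨C, max 1 (2 * r), hC, le_max_left _ _, fun i k => ?_⟩
  have h1 : |iteratedFDeriv ℝ (i + k) f 0
      (fun n : Fin (i + k) => if (n : ℕ) < i then ((1 : ℝ), (0 : ℝ)) else ((0 : ℝ), (1 : ℝ)))| ≤
      (i + k).factorial * (C * r ^ (i + k)) := by
    -- The derivative is the sum of the `n`-th series term over all `n!` permutations of the
    -- arguments. The factorial is absorbed by `(i + k)! ≤ 2 ^ (i + k) i! k!`, whence the factor `2`
    -- in `M`.
    rw [hs.iteratedFDeriv_eq_sum_of_completeSpace]
    refine (Finset.abs_sum_le_sum_abs _ _).trans ?_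
    have : ∀ σ ∈ (Finset.univ : Finset (Equiv.Perm (Fin (i + k)))), |s (i + k) (fun j =>
        if (σ j : ℕ) < i then ((1 : ℝ), (0 : ℝ)) else ((0 : ℝ), (1 : ℝ)))| ≤ C * r ^ (i + k) := by
      intro σ _
      refine ((s (i + k)).le_opNorm _).trans ?_
      rw [Finset.prod_eq_one, mul_one]
      · exact hCr _
      · intro j _
        split_ifs <;> simp [Prod.norm_def]
    refine (Finset.sum_le_card_nsmul _ _ _ this).trans ?_
    simp [Fintype.card_perm]
  have h2 : ((i + k).factorial : ℝ) ≤ 2 ^ (i + k) * (i.factorial * k.factorial) := by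
    have h3 := Nat.add_choose_mul_factorial_mul_factorial i k
    have h4 := Nat.choose_le_two_pow (i + k) k
    have : (i + k).factorial ≤ 2 ^ (i + k) * (i.factorial * k.factorial) := by
      rw [← h3, mul_assoc]
      exact Nat.mul_le_mul_right _ h4
    exact_mod_cast this
  have h5 : (0 : ℝ) < i.factorial * k.factorial := by positivity
  rw [taylorCoeff, abs_div, abs_of_pos h5, div_le_iff₀ h5]
  calc _ ≤ (i + k).factorial * (C * r ^ (i + k)) := h1
    _ ≤ 2 ^ (i + k) * (i.factorial * k.factorial) * (C * r ^ (i + k)) := by gcongr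
    _ = C * (2 * r) ^ (i + k) * (i.factorial * k.factorial) := by rw [mul_pow]; ring
    _ ≤ _ := by gcongr; exact le_max_right _ _

theorem eventually_hasSum_taylorCoeff {f : ℝ × ℝ → ℝ} (hf : AnalyticAt ℝ f 0) :
    ∀ᶠ z in 𝓝 (0 : ℝ × ℝ),
      HasSum (fun m : ℕ × ℕ => taylorCoeff f m.1 m.2 * z.1 ^ m.1 * z.2 ^ m.2) (f z) := by
  obtain ⟨C, M, hC, hM, hCM⟩ := exists_abs_taylorCoeff_le hf
  obtain ⟨s, R, hs⟩ := id hf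
  have hM0 : 0 < M := by linarith
  have h1 : ∀ᶠ z : ℝ × ℝ in 𝓝 0, z ∈ Metric.eball 0 R := Metric.eball_mem_nhds _ hs.r_pos
  have h2 : ∀ᶠ z : ℝ × ℝ in 𝓝 0, ‖z‖ < M⁻¹ :=
    (continuous_norm.tendsto' (0 : ℝ × ℝ) 0 norm_zero).eventually (gt_mem_nhds (by positivity))
  filter_upwards [h1, h2] with z hz1 hz2
  have hx : M * |z.1| < 1 := by
    have := mul_lt_mul_of_pos_left ((norm_fst_le z).trans_lt hz2) hM0
    rwa [mul_inv_cancel₀ hM0.ne'] at this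
  have hy : M * |z.2| < 1 := by
    have := mul_lt_mul_of_pos_left ((norm_snd_le z).trans_lt hz2) hM0
    rwa [mul_inv_cancel₀ hM0.ne'] at this
  have hsum : Summable (fun m : ℕ × ℕ => taylorCoeff f m.1 m.2 * z.1 ^ m.1 * z.2 ^ m.2) := by
    have hg := ((summable_geometric_of_lt_one (by positivity) hx).mul_of_nonneg
      (summable_geometric_of_lt_one (by positivity) hy) (fun _ => by positivity)
      (fun _ => by positivity)).mul_left C
    refine Summable.of_norm_bounded hg fun m => ?_
    rw [norm_mul, norm_mul, norm_pow, norm_pow, Real.norm_eq_abs, Real.norm_eq_abs,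
      Real.norm_eq_abs]
    calc _ ≤ C * M ^ (m.1 + m.2) * |z.1| ^ m.1 * |z.2| ^ m.2 := by gcongr; exact hCM _ _
      _ = _ := by rw [mul_pow, mul_pow, pow_add]; ring
  have h3 := hs.hasSum_iteratedFDeriv hz1
  simp only [smul_eq_mul, iteratedFDeriv_const_apply hf, zero_add] at h3
  have h4 := (Finset.HasAntidiagonal.sigmaAntidiagonalEquivProd.hasSum_iff.mpr hsum.hasSum).sigma
    (fun n => hasSum_fintype _)
  have h5 := h4.unique (a₂ := f z) (by
    -- The absolutely summable double series, grouped along antidiagonals, is the Taylor series of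
    -- `f`.
    convert! h3 with n
    exact (Finset.sum_coe_sort (Finset.HasAntidiagonal.antidiagonal n)
      (fun m : ℕ × ℕ => taylorCoeff f m.1 m.2 * z.1 ^ m.1 * z.2 ^ m.2)))
  exact h5 ▸ hsum.hasSum

theorem eventually_hasSum_qhPart {f : ℝ × ℝ → ℝ} (hf : AnalyticAt ℝ f 0) {p q : ℕ} (hp : 0 < p)
    (hq : 0 < q) : ∀ᶠ z in 𝓝 (0 : ℝ × ℝ), HasSum (fun j => qhPart p q f j z) (f z) := by
  filter_upwards [eventually_hasSum_taylorCoeff hf] with z hz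
  have h := hz.tsum_fiberwise (fun m : ℕ × ℕ => p * m.1 + q * m.2)
  convert! h with j
  have : ((fun m : ℕ × ℕ => p * m.1 + q * m.2) ⁻¹' {j}) =
      ((Finset.range (j + 1) ×ˢ Finset.range (j + 1)).filter
        (fun m => p * m.1 + q * m.2 = j) : Finset (ℕ × ℕ)) := by
    ext m
    simp only [mem_preimage, mem_singleton_iff, Finset.coe_filter, Finset.mem_product,
      Finset.mem_range, mem_ofPred_eq]
    constructor
    · intro hm
      refine ⟨⟨?_, ?_⟩, hm⟩ <;> nlinarith
    · exact fun hm => hm.2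
  rw [this]
  exact (Finset.tsum_subtype _ (fun m : ℕ × ℕ => taylorCoeff f m.1 m.2 * z.1 ^ m.1 * z.2 ^ m.2)).symm

theorem qhPart_weighted (p q : ℕ) (f : ℝ × ℝ → ℝ) (j : ℕ) (l x y : ℝ) :
    qhPart p q f j (l ^ p * x, l ^ q * y) = l ^ j * qhPart p q f j (x, y) := by
  simp only [qhPart, Finset.mul_sum]
  refine Finset.sum_congr rfl fun m hm => ?_
  rw [← (Finset.mem_filter.mp hm).2, mul_pow, mul_pow, pow_add, pow_mul, pow_mul]
  ring

theorem continuous_qhPart (p q : ℕ) (f : ℝ × ℝ → ℝ) (j : ℕ) : Continuous (qhPart p q f j) := by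
  unfold qhPart
  fun_prop

theorem exists_abs_qhPart_le {f : ℝ × ℝ → ℝ} (hf : AnalyticAt ℝ f 0) {p q : ℕ} (hp : 0 < p)
    (hq : 0 < q) : ∃ C M : ℝ, 0 < C ∧ 1 ≤ M ∧ ∀ j x y, |x| ≤ 1 → |y| ≤ 1 →
      |qhPart p q f j (x, y)| ≤ C * M ^ j := by
  obtain ⟨C, M, hC, hM, hCM⟩ := exists_abs_taylorCoeff_le hf
  -- The factor `4 ^ j` bounds the number of monomials, at most `(j + 1) ^ 2`.
  refine ⟨C, 4 * M, hC, by linarith, fun j x y hx hy => ?_⟩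
  refine (Finset.abs_sum_le_sum_abs _ _).trans ?_
  have : ∀ m ∈ (Finset.range (j + 1) ×ˢ Finset.range (j + 1)).filter
      (fun m => p * m.1 + q * m.2 = j),
      |taylorCoeff f m.1 m.2 * x ^ m.1 * y ^ m.2| ≤ C * M ^ j := by
    intro m hm
    have hmj := (Finset.mem_filter.mp hm).2
    have : m.1 + m.2 ≤ j := by nlinarith
    rw [abs_mul, abs_mul, abs_pow, abs_pow]
    calc _ ≤ |taylorCoeff f m.1 m.2| * 1 * 1 := by
          gcongr
          · exact pow_le_one₀ (abs_nonneg _) hx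
          · exact pow_le_one₀ (abs_nonneg _) hy
      _ ≤ C * M ^ (m.1 + m.2) := by simpa using hCM _ _
      _ ≤ C * M ^ j := by gcongr
  refine (Finset.sum_le_card_nsmul _ _ _ this).trans ?_
  have h1 := Finset.card_filter_le (Finset.range (j + 1) ×ˢ Finset.range (j + 1))
    (fun m : ℕ × ℕ => p * m.1 + q * m.2 = j)
  have h2 : j + 1 ≤ 2 ^ j := Nat.lt_two_pow_self
  have h3 : ((Finset.range (j + 1) ×ˢ Finset.range (j + 1)).filter
      (fun m => p * m.1 + q * m.2 = j)).card ≤ 4 ^ j := by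
    refine h1.trans ?_
    rw [Finset.card_product, Finset.card_range, show 4 = 2 * 2 from rfl, mul_pow]
    exact Nat.mul_le_mul h2 h2
  have h4 : ((((Finset.range (j + 1) ×ˢ Finset.range (j + 1)).filter
      (fun m => p * m.1 + q * m.2 = j)).card : ℕ) : ℝ) ≤ 4 ^ j := by exact_mod_cast h3
  rw [nsmul_eq_mul, mul_pow]
  calc _ ≤ 4 ^ j * (C * M ^ j) := by gcongr
    _ = _ := by ring

/-! ### Derivatives, orders along weighted curves, and the inequality `r ≤ rbar`. -/

theorem iteratedFDeriv_fderiv_apply {f : ℝ × ℝ → ℝ} (hf : AnalyticAt ℝ f 0) (n : ℕ) (e : ℝ × ℝ)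
    (v : Fin n → ℝ × ℝ) :
    iteratedFDeriv ℝ n (fun z => fderiv ℝ f z e) 0 v =
      iteratedFDeriv ℝ (n + 1) f 0 (Fin.snoc v e) := by
  rw [iteratedFDeriv_succ_apply_right]
  have h := (ContinuousLinearMap.apply ℝ ℝ e).iteratedFDeriv_comp_left
    (f := fderiv ℝ f) (x := 0) (n := (n : ℕ∞)) (i := n) hf.fderiv.contDiffAt le_rfl
  have h2 : (fun z => fderiv ℝ f z e) = (ContinuousLinearMap.apply ℝ ℝ e) ∘ fderiv ℝ f := by
    ext; simp
  rw [h2, h]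
  simp [Fin.init_snoc, Fin.snoc_last]

theorem taylorCoeff_fderiv_snd {f : ℝ × ℝ → ℝ} (hf : AnalyticAt ℝ f 0) (i k : ℕ) :
    taylorCoeff (fun z => fderiv ℝ f z (0, 1)) i k = (k + 1) * taylorCoeff f i (k + 1) := by
  unfold taylorCoeff
  rw [iteratedFDeriv_fderiv_apply hf]
  have : (Fin.snoc (fun n : Fin (i + k) => if (n : ℕ) < i then ((1 : ℝ), (0 : ℝ))
      else ((0 : ℝ), (1 : ℝ))) ((0 : ℝ), (1 : ℝ)) : Fin (i + k + 1) → ℝ × ℝ) =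
      fun n : Fin (i + (k + 1)) => if (n : ℕ) < i then ((1 : ℝ), (0 : ℝ))
        else ((0 : ℝ), (1 : ℝ)) := by
    ext1 n
    refine Fin.lastCases ?_ (fun n => ?_) n <;> simp
  rw [this, Nat.factorial_succ]
  have h1 : ((k : ℝ) + 1) ≠ 0 := by positivity
  have := Nat.factorial_pos k
  have := Nat.factorial_pos i
  push_cast
  change iteratedFDeriv ℝ (i + (k + 1)) f 0 _ / _ = _
  field_simp

theorem taylorCoeff_fderiv_fst {f : ℝ × ℝ → ℝ} (hf : AnalyticAt ℝ f 0) (i k : ℕ) :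
    taylorCoeff (fun z => fderiv ℝ f z (1, 0)) i k = (i + 1) * taylorCoeff f (i + 1) k := by
  classical
  unfold taylorCoeff
  rw [iteratedFDeriv_fderiv_apply hf]
  have : (Fin.snoc (fun n : Fin (i + k) => if (n : ℕ) < i then ((1 : ℝ), (0 : ℝ))
      else ((0 : ℝ), (1 : ℝ))) ((1 : ℝ), (0 : ℝ)) : Fin (i + k + 1) → ℝ × ℝ) =
      (Finset.univ.filter fun n : Fin (i + k + 1) => (n : ℕ) < i ∨ n = Fin.last _).piecewise
        (fun _ => ((1 : ℝ), (0 : ℝ))) (fun _ => ((0 : ℝ), (1 : ℝ))) := by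
    ext1 n
    refine Fin.lastCases ?_ (fun n => ?_) n <;> simp [Finset.piecewise, Fin.ext_iff]
    simp [n.2.ne]
  rw [this, iteratedFDeriv_piecewise_eq hf]
  have hc : (Finset.univ.filter fun n : Fin (i + k + 1) => (n : ℕ) < i ∨ n = Fin.last _).card
      = i + 1 := by
    have h1 := Fin.card_filter_val_lt (n := i + k) (m := i)
    rw [Fin.univ_castSuccEmb, Finset.filter_cons]
    simp only [or_true, if_true, Finset.card_cons, Finset.filter_map, Finset.card_map]
    have : (Finset.univ.filter ((fun n : Fin (i + k + 1) => (n : ℕ) < i ∨ n = Fin.last (i + k)) ∘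
        Fin.castSuccEmb)) = Finset.univ.filter fun n : Fin (i + k) => (n : ℕ) < i := by
      ext n
      simp [Fin.ext_iff, n.2.ne]
    rw [this, h1]
    omega
  rw [hc, show i + k + 1 = i + 1 + k by ring, Nat.factorial_succ]
  have h1 : ((i : ℝ) + 1) ≠ 0 := by positivity
  have := Nat.factorial_pos k
  have := Nat.factorial_pos i
  push_cast
  field_simp

/-- The one-variable formal power series with coefficients `c n`. -/
def seriesOfCoeff {E : Type*} [NormedAddCommGroup E] [NormedSpace ℝ E] (c : ℕ → E) :
    FormalMultilinearSeries ℝ ℝ E :=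
  fun n => ContinuousMultilinearMap.mkPiRing ℝ (Fin n) (c n)

theorem coeff_seriesOfCoeff {E : Type*} [NormedAddCommGroup E] [NormedSpace ℝ E] (c : ℕ → E)
    (n : ℕ) : (seriesOfCoeff c).coeff n = c n := by
  simp [seriesOfCoeff, FormalMultilinearSeries.coeff]

theorem hasFPowerSeriesAt_seriesOfCoeff {E : Type*} [NormedAddCommGroup E] [NormedSpace ℝ E]
    {c : ℕ → E} {h : ℝ → E} (hs : ∀ᶠ t in 𝓝 (0 : ℝ), HasSum (fun n => t ^ n • c n) (h t)) :
    HasFPowerSeriesAt h (seriesOfCoeff c) 0 := by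
  rw [hasFPowerSeriesAt_iff]
  simpa only [coeff_seriesOfCoeff, zero_add] using hs

theorem tendsto_weighted_div_pow {f : ℝ × ℝ → ℝ} (hf : AnalyticAt ℝ f 0) {p q : ℕ} (hp : 0 < p)
    (hq : 0 < q) {s : ℕ} (x y : ℝ) (hs : ∀ j < s, qhPart p q f j (x, y) = 0) :
    Tendsto (fun l : ℝ => f (l ^ p * x, l ^ q * y) / l ^ s) (𝓝[>] 0)
      (𝓝 (qhPart p q f s (x, y))) := by
  have hcont : Tendsto (fun l : ℝ => (l ^ p * x, l ^ q * y)) (𝓝 0) (𝓝 (0 : ℝ × ℝ)) := by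
    have : Continuous fun l : ℝ => (l ^ p * x, l ^ q * y) := by fun_prop
    refine this.tendsto' _ _ ?_
    simp [hp.ne', hq.ne']
  have h1 := hcont.eventually (eventually_hasSum_qhPart hf hp hq)
  -- With the right value at `l = 0`, the quotient is the sum of a power series in `l`, hence
  -- continuous there.
  have h2 : ∀ᶠ l : ℝ in 𝓝 0, HasSum (fun n => l ^ n • qhPart p q f (n + s) (x, y))
      (if l = 0 then qhPart p q f s (x, y) else f (l ^ p * x, l ^ q * y) / l ^ s) := by
    filter_upwards [h1] with l hl
    split_ifs with h0
    · subst h0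
      have := hasSum_single (f := fun n => (0 : ℝ) ^ n • qhPart p q f (n + s) (x, y)) 0
        (fun n hn => by simp [hn])
      simpa using this
    · simp only [qhPart_weighted] at hl
      rw [← hasSum_nat_add_iff' s] at hl
      rw [Finset.sum_eq_zero (fun j hj => by rw [hs j (Finset.mem_range.mp hj), mul_zero]),
        sub_zero] at hl
      convert! hl.div_const (l ^ s) using 1
      ext n
      rw [pow_add, smul_eq_mul]
      field_simp
  have h3 := (hasFPowerSeriesAt_seriesOfCoeff h2).analyticAt.continuousAt.tendsto
  simp only [if_true] at h3
  refine (h3.mono_left nhdsWithin_le_nhds).congr' ?_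
  filter_upwards [self_mem_nhdsWithin] with l hl
  rw [if_neg (ne_of_gt hl)]

theorem hasDerivAt_qhPart_fst {f : ℝ × ℝ → ℝ} (hf : AnalyticAt ℝ f 0) {p q : ℕ} (hp : 0 < p)
    (hq : 0 < q) (j : ℕ) (x y : ℝ) :
    HasDerivAt (fun x => qhPart p q f (j + p) (x, y))
      (qhPart p q (fun z => fderiv ℝ f z (1, 0)) j (x, y)) x := by
  unfold qhPart
  have h : HasDerivAt (fun x => ∑ m ∈ (Finset.range (j + p + 1) ×ˢ Finset.range (j + p + 1)).filter
      (fun m => p * m.1 + q * m.2 = j + p), taylorCoeff f m.1 m.2 * x ^ m.1 * y ^ m.2)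
      (∑ m ∈ (Finset.range (j + p + 1) ×ˢ Finset.range (j + p + 1)).filter
      (fun m => p * m.1 + q * m.2 = j + p),
        taylorCoeff f m.1 m.2 * (m.1 * x ^ (m.1 - 1)) * y ^ m.2) x :=
    HasDerivAt.fun_sum fun m _ => ((hasDerivAt_pow m.1 x).const_mul _).mul_const _
  convert! h using 1
  -- The monomials missed by this reindexing have no factor `x`, so their derivative vanishes.
  refine Finset.sum_of_injOn (fun m => (m.1 + 1, m.2)) ?_ ?_ ?_ ?_
  · intro a _ b _ hab
    simpa [Prod.ext_iff] using hab
  · intro m hm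
    simp only [Finset.coe_filter, Finset.mem_product, Finset.mem_range, mem_ofPred_eq] at hm ⊢
    refine ⟨⟨by omega, by omega⟩, by rw [mul_add]; omega⟩
  · intro m hm hm'
    rcases Nat.eq_zero_or_pos m.1 with h0 | h0
    · simp [h0]
    · refine absurd ?_ hm'
      simp only [Finset.mem_filter, Finset.mem_product, Finset.mem_range] at hm
      obtain ⟨n, hn⟩ := Nat.exists_eq_add_of_lt h0
      refine ⟨(n, m.2), ?_, by ext <;> simp [hn]⟩
      rw [hn, zero_add, mul_add] at hm
      have h1 := Nat.le_mul_of_pos_left n hp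
      have h2 := Nat.le_mul_of_pos_left m.2 hq
      simp only [Finset.coe_filter, Finset.mem_product, Finset.mem_range, mem_ofPred_eq]
      refine ⟨⟨?_, ?_⟩, ?_⟩ <;> omega
  · intro m _
    rw [taylorCoeff_fderiv_fst hf]
    simp only [Nat.add_sub_cancel, Nat.cast_add, Nat.cast_one]
    ring

theorem hasDerivAt_qhPart_snd {f : ℝ × ℝ → ℝ} (hf : AnalyticAt ℝ f 0) {p q : ℕ} (hp : 0 < p)
    (hq : 0 < q) (j : ℕ) (x y : ℝ) :
    HasDerivAt (fun y => qhPart p q f (j + q) (x, y))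
      (qhPart p q (fun z => fderiv ℝ f z (0, 1)) j (x, y)) y := by
  unfold qhPart
  have h : HasDerivAt (fun y => ∑ m ∈ (Finset.range (j + q + 1) ×ˢ Finset.range (j + q + 1)).filter
      (fun m => p * m.1 + q * m.2 = j + q), taylorCoeff f m.1 m.2 * x ^ m.1 * y ^ m.2)
      (∑ m ∈ (Finset.range (j + q + 1) ×ˢ Finset.range (j + q + 1)).filter
      (fun m => p * m.1 + q * m.2 = j + q),
        taylorCoeff f m.1 m.2 * x ^ m.1 * (m.2 * y ^ (m.2 - 1))) y :=
    HasDerivAt.fun_sum fun m _ => (hasDerivAt_pow m.2 y).const_mul _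
  convert! h using 1
  refine Finset.sum_of_injOn (fun m => (m.1, m.2 + 1)) ?_ ?_ ?_ ?_
  · intro a _ b _ hab
    simpa [Prod.ext_iff] using hab
  · intro m hm
    simp only [Finset.coe_filter, Finset.mem_product, Finset.mem_range, mem_ofPred_eq] at hm ⊢
    refine ⟨⟨by omega, by omega⟩, by rw [mul_add]; omega⟩
  · intro m hm hm'
    rcases Nat.eq_zero_or_pos m.2 with h0 | h0
    · simp [h0]
    · refine absurd ?_ hm'
      simp only [Finset.mem_filter, Finset.mem_product, Finset.mem_range] at hm
      obtain ⟨n, hn⟩ := Nat.exists_eq_add_of_lt h0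
      refine ⟨(m.1, n), ?_, by ext <;> simp [hn]⟩
      rw [hn, zero_add, mul_add] at hm
      have h1 := Nat.le_mul_of_pos_left m.1 hp
      have h2 := Nat.le_mul_of_pos_left n hq
      simp only [Finset.coe_filter, Finset.mem_product, Finset.mem_range, mem_ofPred_eq]
      refine ⟨⟨?_, ?_⟩, ?_⟩ <;> omega
  · intro m _
    rw [taylorCoeff_fderiv_snd hf]
    simp only [Nat.add_sub_cancel, Nat.cast_add, Nat.cast_one]
    ring

theorem analyticOnNhd_qhPart (p q : ℕ) (f : ℝ × ℝ → ℝ) (j : ℕ) :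
    AnalyticOnNhd ℝ (qhPart p q f j) univ := by
  intro z _
  unfold qhPart
  refine Finset.analyticAt_fun_sum _ fun m _ => ?_
  exact (analyticAt_const.mul (analyticAt_fst.pow _)).mul (analyticAt_snd.pow _)

theorem exists_qhPart_ne_zero {f : ℝ × ℝ → ℝ} (hf : AnalyticAt ℝ f 0)
    (hne : ¬ ∀ᶠ z in 𝓝 (0 : ℝ × ℝ), f z = 0) {p q : ℕ} (hp : 0 < p) (hq : 0 < q) :
    ∃ s, (∀ j < s, ∀ z, qhPart p q f j z = 0) ∧ ∃ z, qhPart p q f s z ≠ 0 := by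
  classical
  have hex : ∃ s, ∃ z, qhPart p q f s z ≠ 0 := by
    by_contra! h
    refine hne ?_
    filter_upwards [eventually_hasSum_qhPart hf hp hq] with z hz
    simp only [h] at hz
    exact hz.unique hasSum_zero
  refine ⟨Nat.find hex, fun j hj z => ?_, Nat.find_spec hex⟩
  by_contra hz
  exact Nat.find_min hex hj ⟨z, hz⟩

theorem fderiv_prod_apply (f : ℝ × ℝ → ℝ) (z : ℝ × ℝ) (a b : ℝ) :
    fderiv ℝ f z (a, b) = a * fderiv ℝ f z (1, 0) + b * fderiv ℝ f z (0, 1) := by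
  have : ((a, b) : ℝ × ℝ) = a • (1, 0) + b • (0, 1) := by simp
  rw [this, map_add, map_smul, map_smul, smul_eq_mul, smul_eq_mul]

theorem leadingDegree_le_of_cofactor {p q r rbar : ℕ} {P Q F K : ℝ × ℝ → ℝ} (hp : 0 < p)
    (hq : 0 < q) (hP : AnalyticAt ℝ P 0) (hQ : AnalyticAt ℝ Q 0)
    (hP0 : ∀ m < p + r, ∀ z, qhPart p q P m z = 0) (hQ0 : ∀ m < q + r, ∀ z, qhPart p q Q m z = 0)
    (hF : AnalyticAt ℝ F 0) (hFne : ¬ ∀ᶠ z in 𝓝 (0 : ℝ × ℝ), F z = 0) (hK : AnalyticAt ℝ K 0)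
    (hinv : ∀ᶠ z in 𝓝 (0 : ℝ × ℝ), fderiv ℝ F z (P z, Q z) = K z * F z)
    (hrbar : ∀ j < rbar, ∀ z, qhPart p q K j z = 0) (hKne : ∃ z, qhPart p q K rbar z ≠ 0) :
    r ≤ rbar := by
  by_contra! hlt
  obtain ⟨s, hs0, zs, hzs⟩ := exists_qhPart_ne_zero hF hFne hp hq
  have hFx : AnalyticAt ℝ (fun z => fderiv ℝ F z (1, 0)) 0 :=
    ((ContinuousLinearMap.apply ℝ ℝ ((1 : ℝ), (0 : ℝ))).analyticAt _).comp hF.fderiv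
  have hFy : AnalyticAt ℝ (fun z => fderiv ℝ F z (0, 1)) 0 :=
    ((ContinuousLinearMap.apply ℝ ℝ ((0 : ℝ), (1 : ℝ))).analyticAt _).comp hF.fderiv
  have hFx0 : ∀ j < s - p, ∀ x y, qhPart p q (fun z => fderiv ℝ F z (1, 0)) j (x, y) = 0 := by
    intro j hj x y
    refine (hasDerivAt_qhPart_fst hF hp hq j x y).unique ?_
    simp only [hs0 (j + p) (by omega)]
    exact hasDerivAt_const _ _
  have hFy0 : ∀ j < s - q, ∀ x y, qhPart p q (fun z => fderiv ℝ F z (0, 1)) j (x, y) = 0 := by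
    intro j hj x y
    refine (hasDerivAt_qhPart_snd hF hp hq j x y).unique ?_
    simp only [hs0 (j + q) (by omega)]
    exact hasDerivAt_const _ _
  have key : ∀ x y, qhPart p q K rbar (x, y) * qhPart p q F s (x, y) = 0 := by
    intro x y
    have tK := tendsto_weighted_div_pow hK hp hq x y (fun j hj => hrbar j hj _)
    have tF := tendsto_weighted_div_pow hF hp hq x y (fun j hj => hs0 j hj _)
    have tP := tendsto_weighted_div_pow hP hp hq x y (fun j hj => hP0 j hj _)
    have tQ := tendsto_weighted_div_pow hQ hp hq x y (fun j hj => hQ0 j hj _)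
    have tx := tendsto_weighted_div_pow hFx hp hq x y (fun j hj => hFx0 j hj x y)
    have ty := tendsto_weighted_div_pow hFy hp hq x y (fun j hj => hFy0 j hj x y)
    have tpow : ∀ n : ℕ, 0 < n → Tendsto (fun l : ℝ => l ^ n) (𝓝[>] 0) (𝓝 0) := fun n hn =>
      ((continuous_pow n).tendsto' 0 0 (zero_pow hn.ne')).mono_left nhdsWithin_le_nhds
    have hcont : Tendsto (fun l : ℝ => (l ^ p * x, l ^ q * y)) (𝓝[>] 0) (𝓝 (0 : ℝ × ℝ)) := by
      have : Continuous fun l : ℝ => (l ^ p * x, l ^ q * y) := by fun_prop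
      refine (this.tendsto' _ _ ?_).mono_left nhdsWithin_le_nhds
      simp [hp.ne', hq.ne']
    -- The extra exponents are positive since `s ≤ p + (s - p)` even when the subtraction truncates,
    -- and `rbar < r`; so both terms of the left side tend to `0` after division by `l ^ (rbar +
    -- s)`.
    have t1 := ((tP.mul tx).mul (tpow (p + r + (s - p) - (rbar + s)) (by omega))).add
      ((tQ.mul ty).mul (tpow (q + r + (s - q) - (rbar + s)) (by omega)))
    rw [mul_zero, mul_zero, add_zero] at t1
    refine tendsto_nhds_unique (tK.mul tF) (t1.congr' ?_)
    filter_upwards [hcont.eventually hinv, self_mem_nhdsWithin] with l hl hl0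
    have hl0' : l ≠ 0 := ne_of_gt hl0
    rw [fderiv_prod_apply] at hl
    obtain ⟨n₁, hn₁⟩ : ∃ n, p + r + (s - p) = rbar + s + n :=
      Nat.exists_eq_add_of_le (by omega)
    obtain ⟨n₂, hn₂⟩ : ∃ n, q + r + (s - q) = rbar + s + n :=
      Nat.exists_eq_add_of_le (by omega)
    rw [div_mul_div_comm, div_mul_div_comm, div_mul_div_comm, ← pow_add, ← pow_add, ← pow_add,
      ← hl, hn₁, hn₂, Nat.add_sub_cancel_left, Nat.add_sub_cancel_left, pow_add _ _ n₁,
      pow_add _ _ n₂]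
    field_simp
  obtain ⟨z, hz⟩ := hKne
  refine hzs ((analyticOnNhd_qhPart p q F s).eq_of_eventuallyEq (g := 0) (z₀ := z)
    (fun _ _ => analyticAt_const) ?_ ▸ rfl)
  filter_upwards [(continuous_qhPart p q K rbar).continuousAt.eventually_ne hz] with w hw
  exact (mul_eq_zero.mp (key w.1 w.2)).resolve_left hw

/-! ### Monodromy of the leading part and the zeros of `polarG`. -/

/-- Integrating factor. It serves twice: a solution that starts at zero stays zero, and in general a
solution keeps its sign. -/
theorem exists_pos_factor_of_linear_ode {f m : ℝ → ℝ} {T : ℝ} (hT : 0 < T)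
    (hm : ContinuousOn m (Icc 0 T))
    (hf : ∀ t ∈ Icc 0 T, HasDerivWithinAt f (m t * f t) (Icc 0 T) t) :
    ∃ e : ℝ → ℝ, ∀ t ∈ Icc 0 T, 0 < e t ∧ f t = f 0 * e t := by
  set M : ℝ → ℝ := IccExtend hT.le ((Icc 0 T).domRestrict m) with hMdef
  have hMc : Continuous M := hm.domRestrict.Icc_extend'
  have hMe : ∀ t ∈ Icc 0 T, M t = m t := fun t ht => by
    rw [hMdef, IccExtend_of_mem _ _ ht, domRestrict_apply]
  have hI : ∀ t, HasDerivAt (fun t => ∫ s in (0 : ℝ)..t, M s) (M t) t := fun t =>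
    intervalIntegral.integral_hasDerivAt_right (hMc.intervalIntegrable _ _)
      (hMc.stronglyMeasurableAtFilter _ _) hMc.continuousAt
  have hder : ∀ t ∈ Icc 0 T,
      HasDerivWithinAt (fun t => f t * exp (-∫ s in (0 : ℝ)..t, M s)) 0 (Icc 0 T) t := by
    intro t ht
    have h := (hf t ht).mul (hI t).neg.exp.hasDerivWithinAt
    convert! h using 1
    rw [hMe t ht]
    ring
  have hconst := constant_of_derivWithin_zero
    (fun t ht => (hder t ht).differentiableWithinAt)
    (fun t ht => (hder t (Ico_subset_Icc_self ht)).derivWithin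
      (uniqueDiffOn_Icc hT t (Ico_subset_Icc_self ht)))
  refine ⟨fun t => exp (∫ s in (0 : ℝ)..t, M s), fun t ht => ⟨exp_pos _, ?_⟩⟩
  have h1 := hconst t ht
  simp only [intervalIntegral.integral_same, neg_zero, exp_zero, mul_one] at h1
  rw [← h1, mul_assoc, ← exp_add, neg_add_cancel, exp_zero, mul_one]

/-- Euler's identity: differentiate `qhPart_weighted` in the scale `l` at `l = 1`. -/
theorem euler_qhPart (p q : ℕ) (f : ℝ × ℝ → ℝ) (j : ℕ) (x y : ℝ) :
    p * x * fderiv ℝ (qhPart p q f j) (x, y) (1, 0) +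
      q * y * fderiv ℝ (qhPart p q f j) (x, y) (0, 1) = j * qhPart p q f j (x, y) := by
  have hd : HasFDerivAt (qhPart p q f j) (fderiv ℝ (qhPart p q f j) (x, y))
      ((1 : ℝ) ^ p * x, (1 : ℝ) ^ q * y) := by
    simpa using (analyticOnNhd_qhPart p q f j (x, y) (mem_univ _)).differentiableAt.hasFDerivAt
  have h1 := hd.comp_hasDerivAt (1 : ℝ) (((hasDerivAt_pow p (1 : ℝ)).mul_const x).prodMk
    ((hasDerivAt_pow q (1 : ℝ)).mul_const y))
  have h2 := ((hasDerivAt_pow j (1 : ℝ)).mul_const (qhPart p q f j (x, y)))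
  have h3 := h1.unique (h2.congr_of_eventuallyEq
    (Eventually.of_forall fun l => qhPart_weighted p q f j l x y))
  rw [fderiv_prod_apply] at h3
  simpa using h3

theorem polarG_ne_zero_of_isMonodromic {p q r : ℕ} {P Q : ℝ × ℝ → ℝ} (hp : 0 < p) (hq : 0 < q)
    (hmono : IsMonodromic (qhField p q P Q r)) (φ : ℝ) : polarG p q P Q r φ ≠ 0 := by
  intro hG
  obtain ⟨-, h⟩ := hmono
  obtain ⟨W, hW, h⟩ := h univ univ_mem
  have hcont : Tendsto (fun l : ℝ => (l ^ p * cos φ, l ^ q * sin φ)) (𝓝[>] 0)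
      (𝓝 (0 : ℝ × ℝ)) := by
    have : Continuous fun l : ℝ => (l ^ p * cos φ, l ^ q * sin φ) := by fun_prop
    refine (this.tendsto' _ _ ?_).mono_left nhdsWithin_le_nhds
    simp [hp.ne', hq.ne']
  obtain ⟨l, hlW, hl0⟩ := ((hcont.eventually hW).and self_mem_nhdsWithin).exists
  have hl0 : 0 < l := hl0
  have hcs : cos φ ≠ 0 ∨ sin φ ≠ 0 := by
    by_contra! hcs
    have := sin_sq_add_cos_sq φ
    rw [hcs.1, hcs.2] at this
    norm_num at this
  have hzne : ((l ^ p * cos φ, l ^ q * sin φ) : ℝ × ℝ) ≠ 0 := by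
    intro hz
    simp only [Prod.mk_eq_zero, mul_eq_zero, pow_eq_zero_iff', hl0.ne', false_and, false_or] at hz
    rcases hcs with hc | hc
    · exact hc hz.1
    · exact hc hz.2
  obtain ⟨T, hT, γ, d, θ, hγ0, hγ, hθc, hθ⟩ := h _ hlW hzne
  set A := qhPart p q P (p + r) with hA
  set B := qhPart p q Q (q + r) with hB
  have hγd : ∀ t ∈ Icc 0 T, HasDerivWithinAt γ (A (γ t), B (γ t)) (Icc 0 T) t :=
    fun t ht => (hγ t ht).2.1
  have hγc : ContinuousOn γ (Icc 0 T) := fun t ht => (hγd t ht).continuousWithinAt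
  have hx : ∀ t ∈ Icc 0 T, HasDerivWithinAt (fun t => (γ t).1) (A (γ t)) (Icc 0 T) t :=
    fun t ht => (hγd t ht).fst
  have hy : ∀ t ∈ Icc 0 T, HasDerivWithinAt (fun t => (γ t).2) (B (γ t)) (Icc 0 T) t :=
    fun t ht => (hγd t ht).snd
  have hdA : ∀ z, HasFDerivAt A (fderiv ℝ A z) z := fun z =>
    (analyticOnNhd_qhPart p q P _ z (mem_univ _)).differentiableAt.hasFDerivAt
  have hdB : ∀ z, HasFDerivAt B (fderiv ℝ B z) z := fun z =>
    (analyticOnNhd_qhPart p q Q _ z (mem_univ _)).differentiableAt.hasFDerivAt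
  have hcA : Continuous (fderiv ℝ A) := continuousOn_univ.mp
    (analyticOnNhd_qhPart p q P _).fderiv.continuousOn
  have hcB : Continuous (fderiv ℝ B) := continuousOn_univ.mp
    (analyticOnNhd_qhPart p q Q _).fderiv.continuousOn
  have hAc : Continuous A := continuous_qhPart _ _ _ _
  have hBc : Continuous B := continuous_qhPart _ _ _ _
  -- The wedge of the field with the weighted radial vector `(p x, q y)` satisfies a linear equation
  -- whose coefficient is the divergence, by Euler's identity. It starts at `l ^ (p + q + r) G_r(φ)
  -- = 0`, so it vanishes along the orbit.
  have hw : ∀ t ∈ Icc 0 T, HasDerivWithinAt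
      (fun t => p * (γ t).1 * B (γ t) - q * (γ t).2 * A (γ t))
      ((fderiv ℝ A (γ t) (1, 0) + fderiv ℝ B (γ t) (0, 1)) *
        (p * (γ t).1 * B (γ t) - q * (γ t).2 * A (γ t))) (Icc 0 T) t := by
    intro t ht
    have h1 := (((hx t ht).const_mul (p : ℝ)).mul
      ((hdB (γ t)).comp_hasDerivWithinAt t (hγd t ht))).sub
      (((hy t ht).const_mul (q : ℝ)).mul
      ((hdA (γ t)).comp_hasDerivWithinAt t (hγd t ht)))
    convert! h1 using 1
    rw [fderiv_prod_apply A _ (A (γ t)), fderiv_prod_apply B _ (A (γ t))]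
    have e1 := euler_qhPart p q P (p + r) (γ t).1 (γ t).2
    have e2 := euler_qhPart p q Q (q + r) (γ t).1 (γ t).2
    rw [← hA] at e1
    rw [← hB] at e2
    simp only [Prod.mk.eta, Nat.cast_add, Function.comp_apply] at e1 e2 ⊢
    linear_combination (-A (γ t)) * e2 + B (γ t) * e1
  obtain ⟨e, he⟩ := exists_pos_factor_of_linear_ode hT
    (((hcA.clm_apply continuous_const).add (hcB.clm_apply continuous_const)).comp_continuousOn hγc)
    hw
  have hw0 : ∀ t ∈ Icc 0 T, p * (γ t).1 * B (γ t) = q * (γ t).2 * A (γ t) := by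
    intro t ht
    have h1 := (he t ht).2
    rw [hγ0] at h1
    simp only [hA, hB, qhPart_weighted] at h1
    rw [polarG] at hG
    rw [← sub_eq_zero, h1]
    linear_combination l ^ (p + (q + r)) * e t * hG
  have hdc : ∀ t ∈ Icc 0 T, 0 < ((p : ℝ) * (γ t).1) ^ 2 + ((q : ℝ) * (γ t).2) ^ 2 := by
    intro t ht
    obtain ⟨-, -, hd, hg⟩ := hγ t ht
    have hp' : (0 : ℝ) < p := by exact_mod_cast hp
    have hq' : (0 : ℝ) < q := by exact_mod_cast hq
    rw [hg]
    by_cases hc : cos (θ t) = 0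
    · have hs : sin (θ t) ≠ 0 := by
        intro hs
        have := sin_sq_add_cos_sq (θ t)
        rw [hs, hc] at this
        norm_num at this
      positivity
    · positivity
  have hγ1 : ContinuousOn (fun t => (γ t).1) (Icc 0 T) := continuous_fst.comp_continuousOn hγc
  have hγ2 : ContinuousOn (fun t => (γ t).2) (Icc 0 T) := continuous_snd.comp_continuousOn hγc
  have hAγ : ContinuousOn (fun t => A (γ t)) (Icc 0 T) := hAc.comp_continuousOn hγc
  have hBγ : ContinuousOn (fun t => B (γ t)) (Icc 0 T) := hBc.comp_continuousOn hγc
  -- The field is now `m` times the weighted radial vector, so `x' = p m x` and `y' = q m y`; `m` is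
  -- found by projecting on that vector.
  set m : ℝ → ℝ := fun t => (p * (γ t).1 * A (γ t) + q * (γ t).2 * B (γ t)) /
    (((p : ℝ) * (γ t).1) ^ 2 + ((q : ℝ) * (γ t).2) ^ 2) with hm
  have hmc : ContinuousOn m (Icc 0 T) :=
    ContinuousOn.div (by fun_prop) (by fun_prop) fun t ht => (hdc t ht).ne'
  obtain ⟨e₁, he₁⟩ := exists_pos_factor_of_linear_ode (f := fun t => (γ t).1) (m := fun t => p * m t)
    hT (by fun_prop) (fun t ht => by
      have h1 := hw0 t ht
      have h2 : p * m t * (γ t).1 = A (γ t) := by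
        simp only [hm]
        rw [← mul_div_assoc, div_mul_eq_mul_div, div_eq_iff (hdc t ht).ne']
        linear_combination (q * (γ t).2) * h1
      rw [h2]
      exact hx t ht)
  obtain ⟨e₂, he₂⟩ := exists_pos_factor_of_linear_ode (f := fun t => (γ t).2) (m := fun t => q * m t)
    hT (by fun_prop) (fun t ht => by
      have h1 := hw0 t ht
      have h2 : q * m t * (γ t).2 = B (γ t) := by
        simp only [hm]
        rw [← mul_div_assoc, div_mul_eq_mul_div, div_eq_iff (hdc t ht).ne']
        linear_combination (-(p * (γ t).1)) * h1
      rw [h2]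
      exact hy t ht)
  have hθc' : ContinuousOn (fun t => |θ t - θ 0|) (Icc 0 T) := by fun_prop
  -- At half a turn both coordinates have opposite signs to the initial ones, while the linear
  -- equations preserve signs.
  obtain ⟨t, ht, htπ⟩ := intermediate_value_Icc hT.le hθc'
    (show π ∈ Icc |θ 0 - θ 0| |θ T - θ 0| by
      rw [sub_self, abs_zero, hθ]
      exact ⟨pi_pos.le, by linarith [pi_pos]⟩)
  have hflip : cos (θ t) = -cos (θ 0) ∧ sin (θ t) = -sin (θ 0) := by
    rcases abs_eq pi_pos.le |>.mp htπ with h1 | h1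
    · rw [show θ t = θ 0 + π by linarith]
      exact ⟨cos_add_pi _, sin_add_pi _⟩
    · rw [show θ t = θ 0 - π by linarith]
      exact ⟨cos_sub_pi _, sin_sub_pi _⟩
  have h0 : (0 : ℝ) ∈ Icc 0 T := ⟨le_rfl, hT.le⟩
  obtain ⟨-, -, hd0, hg0⟩ := hγ 0 h0
  obtain ⟨-, -, hdt, hgt⟩ := hγ t ht
  have hx1 := (he₁ t ht).2
  have hy1 := (he₂ t ht).2
  have he1 := (he₁ t ht).1
  have he2 := (he₂ t ht).1
  rw [hgt, hg0, hflip.1, hflip.2] at hx1 hy1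
  have hcos : cos (θ 0) = 0 := by
    have : (d t + d 0 * e₁ t) * cos (θ 0) = 0 := by linear_combination -hx1
    exact (mul_eq_zero.mp this).resolve_left (by positivity)
  have hsin : sin (θ 0) = 0 := by
    have : (d t + d 0 * e₂ t) * sin (θ 0) = 0 := by linear_combination -hy1
    exact (mul_eq_zero.mp this).resolve_left (by positivity)
  have := sin_sq_add_cos_sq (θ 0)
  rw [hsin, hcos] at this
  norm_num at this

/-! ### Power series and an analytic integral equation in a Banach algebra. -/

section BanachAlgebra

variable {A : Type*} [NormedCommRing A]

/-- The sum of the power series with coefficients `c n` in the algebra. -/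
def powerSum (c : ℕ → A) (u : A) : A := ∑' n, c n * u ^ n

theorem powerSum_zero (c : ℕ → A) : powerSum c 0 = c 0 := by
  rw [powerSum, tsum_eq_single 0 (fun n hn => by simp [hn])]
  simp

variable [NormedAlgebra ℝ A]

/-- The formal multilinear series of `powerSum c`. -/
def powerSumSeries (c : ℕ → A) : FormalMultilinearSeries ℝ A A :=
  fun n => (ContinuousLinearMap.mul ℝ A (c n)).compContinuousMultilinearMap
    (ContinuousMultilinearMap.mkPiAlgebraFin ℝ n A)

theorem powerSumSeries_apply (c : ℕ → A) (n : ℕ) (u : A) :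
    powerSumSeries c n (fun _ => u) = c n * u ^ n := by
  simp [powerSumSeries]

variable [CompleteSpace A]

theorem hasFPowerSeriesOnBall_powerSum {c : ℕ → A} {C : ℝ} {M : NNReal} (hM : 0 < M)
    (hc : ∀ n, ‖c n‖ ≤ C * M ^ n) :
    HasFPowerSeriesOnBall (powerSum c) (powerSumSeries c) 0 (M⁻¹ : NNReal) := by
  have hM' : (0 : ℝ) < M := hM
  have hr : ((M⁻¹ : NNReal) : ENNReal) ≤ (powerSumSeries c).radius := by
    -- The factor `max 1 ‖1‖` is there because the unit is not assumed to have norm one.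
    refine (powerSumSeries c).le_radius_of_bound (C * max 1 ‖(1 : A)‖) fun n => ?_
    have h1 : ‖powerSumSeries c n‖ ≤ ‖c n‖ * max 1 ‖(1 : A)‖ := by
      refine (ContinuousLinearMap.norm_compContinuousMultilinearMap_le _ _).trans ?_
      gcongr
      · exact ContinuousLinearMap.opNorm_mul_apply_le _ _ _
      · exact ContinuousMultilinearMap.norm_mkPiAlgebraFin_le
    calc _ ≤ C * M ^ n * max 1 ‖(1 : A)‖ * ((M⁻¹ : NNReal) : ℝ) ^ n := by
          gcongr
          exact h1.trans (by gcongr; exact hc n)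
      _ = _ := by
          rw [NNReal.coe_inv, inv_pow]
          field_simp
  have h := (powerSumSeries c).hasFPowerSeriesOnBall (lt_of_lt_of_le (by simpa using hM) hr)
  refine (h.mono (by simpa using hM) hr).congr fun u _ => ?_
  simp [FormalMultilinearSeries.sum, powerSumSeries_apply, powerSum]

theorem hasSum_powerSum {c : ℕ → A} {C : ℝ} {M : NNReal} (hM : 0 < M)
    (hc : ∀ n, ‖c n‖ ≤ C * M ^ n) {u : A} (hu : ‖u‖ < (M : ℝ)⁻¹) :
    HasSum (fun n => c n * u ^ n) (powerSum c u) := by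
  have h := (hasFPowerSeriesOnBall_powerSum hM hc).hasSum (y := u) (by
    rw [Metric.eball_coe]
    simpa using hu)
  simpa [powerSumSeries_apply] using h

theorem analyticAt_powerSum {c : ℕ → A} {C : ℝ} {M : NNReal} (hM : 0 < M)
    (hc : ∀ n, ‖c n‖ ≤ C * M ^ n) : AnalyticAt ℝ (powerSum c) 0 :=
  (hasFPowerSeriesOnBall_powerSum hM hc).analyticAt

theorem hasFDerivAt_powerSum {c : ℕ → A} {C : ℝ} {M : NNReal} (hM : 0 < M)
    (hc : ∀ n, ‖c n‖ ≤ C * M ^ n) :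
    HasFDerivAt (powerSum c) (ContinuousLinearMap.mul ℝ A (c 1)) 0 := by
  convert! (hasFPowerSeriesOnBall_powerSum hM hc).hasFPowerSeriesAt.hasFDerivAt using 1
  ext u
  simp [powerSumSeries]

/-- The integral equation of the Cauchy problem `u' = u f(u)`, `u(0) = t`, where `a` solves the
linearized problem with `a(0) = 1`, `b = a⁻¹` and `J` is the integral operator. -/
theorem exists_analytic_solution {f : A → A} (hf : AnalyticAt ℝ f 0) (J : A →L[ℝ] A) (a b : A) :
    ∃ u : ℝ → A, AnalyticAt ℝ u 0 ∧ u 0 = 0 ∧ HasDerivAt u a 0 ∧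
      ∀ᶠ t in 𝓝 (0 : ℝ), u t = t • a + a * J (b * u t * (f (u t) - f 0)) := by
  set N : A → A := fun u => u - a * J (b * u * (f u - f 0)) with hN
  have hN0 : N 0 = 0 := by simp [hN]
  have hNa : AnalyticAt ℝ N 0 := by
    have h1 : AnalyticAt ℝ (fun u => b * u * (f u - f 0)) 0 :=
      (analyticAt_const.mul analyticAt_id).mul (hf.sub analyticAt_const)
    exact analyticAt_id.sub (analyticAt_const.mul ((J.analyticAt _).comp h1))
  -- The nonlinear term is a product of two factors vanishing at `0`, so it does not contribute to
  -- the derivative.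
  have hNd : HasFDerivAt N ((ContinuousLinearEquiv.refl ℝ A : A ≃L[ℝ] A) : A →L[ℝ] A) 0 := by
    have h1 : HasFDerivAt (fun u => b * u * (f u - f 0)) (0 : A →L[ℝ] A) 0 := by
      have h2 := ((hasFDerivAt_id (𝕜 := ℝ) (0 : A)).const_mul b).mul
        (hf.differentiableAt.hasFDerivAt.sub_const (f 0))
      convert! h2 using 1
      ext u
      simp
    have h3 := (hasFDerivAt_id (𝕜 := ℝ) (0 : A)).sub ((J.hasFDerivAt.comp 0 h1).const_mul a)
    convert! h3 using 1
    ext u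
    simp
  -- Here `⊤` is the analytic class, so the local inverse is analytic as well.
  have hcd : ContDiffAt ℝ ⊤ N 0 := hNa.contDiffAt
  have hS := hcd.hasStrictFDerivAt' hNd (by simp)
  set Ni := hcd.localInverse hNd (by simp) with hNi
  have hNi0 : Ni 0 = 0 := by
    have := hcd.localInverse_apply_image hNd (by simp)
    rwa [hN0] at this
  have hNia : AnalyticAt ℝ Ni 0 := by
    have := hcd.to_localInverse hNd (by simp)
    rw [hN0] at this
    exact this.analyticAt
  have hNid : HasFDerivAt Ni (ContinuousLinearMap.id ℝ A) 0 := by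
    have := hS.to_localInverse.hasFDerivAt
    rw [hN0] at this
    exact this
  have hright : ∀ᶠ y in 𝓝 (0 : A), N (Ni y) = y := by
    have := hS.eventually_right_inverse
    rw [hN0] at this
    exact this
  have hline : HasDerivAt (fun t : ℝ => t • a) a 0 := by
    simpa using (hasDerivAt_id (0 : ℝ)).smul_const a
  have hline0 : Tendsto (fun t : ℝ => t • a) (𝓝 0) (𝓝 0) := by
    simpa using hline.continuousAt.tendsto
  refine ⟨fun t => Ni (t • a), ?_, by simp [hNi0], ?_, ?_⟩
  · refine AnalyticAt.comp (g := Ni) (by simpa using hNia) ?_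
    exact analyticAt_id.smul analyticAt_const
  · have h0 : HasFDerivAt Ni (ContinuousLinearMap.id ℝ A) ((0 : ℝ) • a) := by simpa using hNid
    exact h0.comp_hasDerivAt (0 : ℝ) hline
  · filter_upwards [hline0.eventually hright] with t ht
    rw [← sub_eq_iff_eq_add]
    exact ht

end BanachAlgebra

/-! ### Uniqueness for the Cauchy problem. -/

/-- The competitor `w` is not assumed small. The set of agreement is closed, and from a point of
agreement `w` stays by continuity in the Lipschitz zone for a while to the right, where Grönwall
uniqueness applies. -/
theorem eqOn_Icc_of_lipschitzOn_near_zero {T ε : ℝ} {K : NNReal} {v : ℝ → ℝ → ℝ}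
    (hv : ∀ t ∈ Icc 0 T, LipschitzOnWith K (v t) (Ioo (-ε) ε)) {u w : ℝ → ℝ}
    (hu : ∀ t ∈ Icc 0 T, HasDerivWithinAt u (v t (u t)) (Icc 0 T) t)
    (hw : ∀ t ∈ Icc 0 T, HasDerivWithinAt w (v t (w t)) (Icc 0 T) t)
    (huε : ∀ t ∈ Icc 0 T, u t ∈ Ioo (-ε) ε) (h0 : w 0 = u 0) : EqOn w u (Icc 0 T) := by
  have huc : ContinuousOn u (Icc 0 T) := fun t ht => (hu t ht).continuousWithinAt
  have hwc : ContinuousOn w (Icc 0 T) := fun t ht => (hw t ht).continuousWithinAt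
  have hcl : IsClosed ({t | w t = u t} ∩ Icc 0 T) := by
    have h := (hwc.sub huc).preimage_isClosed_of_isClosed isClosed_Icc (isClosed_singleton (x := 0))
    convert h using 1
    ext t
    simp [sub_eq_zero, and_comm]
  refine hcl.Icc_subset_of_forall_exists_gt h0 fun x hx y hy => ?_
  obtain ⟨hxe, hx0, hxT⟩ := hx
  have hxI : x ∈ Icc 0 T := ⟨hx0, hxT.le⟩
  have hmem : ∀ t ∈ Ico 0 T, Icc 0 T ∈ 𝓝[≥] t := fun t ht => Icc_mem_nhdsGE_of_mem ht
  have hnear : {t | w t ∈ Ioo (-ε) ε} ∈ 𝓝[≥] x := by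
    have h1 : w x ∈ Ioo (-ε) ε := by
      rw [show w x = u x from hxe]
      exact huε x hxI
    exact ((hwc x hxI).mono_of_mem_nhdsWithin (hmem x ⟨hx0, hxT⟩)) (isOpen_Ioo.mem_nhds h1)
  obtain ⟨b, hb, hbs⟩ := (mem_nhdsGE_iff_exists_mem_Ioc_Ico_subset
    (lt_min (mem_Ioi.mp hy) hxT)).mp hnear
  have hbT : b ≤ T := hb.2.trans (min_le_right _ _)
  have hsub : Icc x b ⊆ Icc 0 T := Icc_subset_Icc hx0 hbT
  have hsub' : ∀ t ∈ Ico x b, t ∈ Ico 0 T := fun t ht => ⟨hx0.trans ht.1, ht.2.trans_le hbT⟩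
  have := ODE_solution_unique_of_mem_Icc_right (s := fun _ => Ioo (-ε) ε)
    (fun t ht => hv t (Ico_subset_Icc_self (hsub' t ht)))
    (hwc.mono hsub)
    (fun t ht => (hw t (Ico_subset_Icc_self (hsub' t ht))).mono_of_mem_nhdsWithin
      (hmem t (hsub' t ht)))
    (fun t ht => hbs ht)
    (huc.mono hsub)
    (fun t ht => (hu t (Ico_subset_Icc_self (hsub' t ht))).mono_of_mem_nhdsWithin
      (hmem t (hsub' t ht)))
    (fun t ht => huε t (Ico_subset_Icc_self (hsub' t ht))) hxe
  exact ⟨b, this ⟨hb.1.le, le_rfl⟩, hb.1, hb.2.trans (min_le_left _ _)⟩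

/-! ### Analytic dependence on the initial value, in `C([0, T])`. -/

section Interval

variable {T : ℝ}

/-- The operator `g ↦ (t ↦ ∫ s in 0..t, g s)` on continuous functions on `[0, T]`. -/
def primitiveOp (hT : 0 ≤ T) : C(Icc (0 : ℝ) T, ℝ) →L[ℝ] C(Icc (0 : ℝ) T, ℝ) :=
  LinearMap.mkContinuous
    { toFun := fun g => ⟨fun t => ∫ s in (0 : ℝ)..t, IccExtend hT g s,
        (intervalIntegral.continuous_primitive
          (fun _ _ => (g.continuous.Icc_extend' (h := hT)).intervalIntegrable _ _) 0).comp
            continuous_subtype_val⟩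
      map_add' := fun g h => by
        ext t
        exact intervalIntegral.integral_add
          ((g.continuous.Icc_extend' (h := hT)).intervalIntegrable _ _)
          ((h.continuous.Icc_extend' (h := hT)).intervalIntegrable _ _)
      map_smul' := fun c g => by
        ext t
        exact intervalIntegral.integral_smul c _ } T fun g => by
    refine (ContinuousMap.norm_le _ (by positivity)).mpr fun t => ?_
    have h1 := intervalIntegral.norm_integral_le_of_norm_le_const (a := 0) (b := (t : ℝ))
      (f := IccExtend hT g) (C := ‖g‖) fun s _ => g.norm_coe_le_norm _
    refine h1.trans ?_
    rw [sub_zero, abs_of_nonneg t.2.1, mul_comm]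
    exact mul_le_mul_of_nonneg_right t.2.2 (norm_nonneg _)

theorem primitiveOp_apply (hT : 0 ≤ T) (g : C(Icc (0 : ℝ) T, ℝ)) (t : Icc (0 : ℝ) T) :
    primitiveOp hT g t = ∫ s in (0 : ℝ)..t, IccExtend hT g s := rfl

theorem hasDerivWithinAt_primitiveOp (hT : 0 ≤ T) (g : C(Icc (0 : ℝ) T, ℝ)) (t : Icc (0 : ℝ) T) :
    HasDerivWithinAt (IccExtend hT (primitiveOp hT g)) (g t) (Icc 0 T) t := by
  have hc : Continuous (IccExtend hT g) := g.continuous.Icc_extend'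
  have h := (intervalIntegral.integral_hasDerivAt_right (hc.intervalIntegrable 0 t)
    (hc.stronglyMeasurableAtFilter _ _) hc.continuousAt).hasDerivWithinAt (s := Icc 0 T)
  rw [IccExtend_val] at h
  refine h.congr (fun s hs => ?_) ?_
  · rw [IccExtend_of_mem _ _ hs, primitiveOp_apply]
  · rw [IccExtend_val, primitiveOp_apply]

theorem ringInverse_apply {X : Type*} [TopologicalSpace X] {g : C(X, ℝ)} (hg : IsUnit g) (t : X) :
    Ring.inverse g t = (g t)⁻¹ := by
  have h := congrArg (fun k : C(X, ℝ) => k t) (Ring.mul_inverse_cancel g hg)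
  simp only [ContinuousMap.mul_apply, ContinuousMap.one_apply] at h
  exact eq_inv_of_mul_eq_one_right h

theorem powerSum_apply {c : ℕ → C(Icc (0 : ℝ) T, ℝ)} {C : ℝ} {M : NNReal} (hM : 0 < M)
    (hc : ∀ n, ‖c n‖ ≤ C * M ^ n) {u : C(Icc (0 : ℝ) T, ℝ)} (hu : ‖u‖ < (M : ℝ)⁻¹)
    (t : Icc (0 : ℝ) T) : HasSum (fun n => u t ^ n * c n t) (powerSum c u t) := by
  have h := (hasSum_powerSum hM hc hu).map (ContinuousMap.evalCLM ℝ t)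
    (ContinuousMap.evalCLM ℝ t).continuous
  convert! h using 1
  ext n
  simp [mul_comm]

/-- The right-hand side `(∑ ρ ^ (j + 1) F j) / (∑ ρ ^ j G j)` as a map of the algebra, without its
factor `ρ`. -/
def quotientSum (F G : ℕ → C(Icc (0 : ℝ) T, ℝ)) (u : C(Icc (0 : ℝ) T, ℝ)) :
    C(Icc (0 : ℝ) T, ℝ) :=
  powerSum F u * Ring.inverse (powerSum G u)

variable {F G : ℕ → C(Icc (0 : ℝ) T, ℝ)} {C : ℝ} {M : NNReal}

theorem eventually_isUnit_powerSum (hM : 0 < M) (hGb : ∀ n, ‖G n‖ ≤ C * M ^ n)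
    (hG0 : ∀ t, G 0 t ≠ 0) : ∀ᶠ u in 𝓝 0, ‖u‖ < (M : ℝ)⁻¹ ∧ IsUnit (powerSum G u) := by
  have h1 : ∀ᶠ u : C(Icc (0 : ℝ) T, ℝ) in 𝓝 0, ‖u‖ < (M : ℝ)⁻¹ :=
    (continuous_norm.tendsto' _ 0 norm_zero).eventually (gt_mem_nhds (by positivity))
  refine h1.and ((analyticAt_powerSum hM hGb).continuousAt.eventually ?_)
  refine Units.isOpen.mem_nhds ?_
  rw [powerSum_zero]
  exact (ContinuousMap.isUnit_iff_forall_ne_zero _).mpr hG0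

theorem analyticAt_ringInverse_powerSum (hM : 0 < M) (hGb : ∀ n, ‖G n‖ ≤ C * M ^ n)
    (hG0 : ∀ t, G 0 t ≠ 0) : AnalyticAt ℝ (fun u => Ring.inverse (powerSum G u)) 0 := by
  obtain ⟨y, hy⟩ := (ContinuousMap.isUnit_iff_forall_ne_zero _).mpr hG0
  refine AnalyticAt.comp (g := Ring.inverse) ?_ (analyticAt_powerSum hM hGb)
  rw [powerSum_zero, ← hy]
  exact analyticAt_inverse y

theorem analyticAt_quotientSum (hM : 0 < M) (hFb : ∀ n, ‖F n‖ ≤ C * M ^ n)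
    (hGb : ∀ n, ‖G n‖ ≤ C * M ^ n) (hG0 : ∀ t, G 0 t ≠ 0) :
    AnalyticAt ℝ (quotientSum F G) 0 :=
  (analyticAt_powerSum hM hFb).mul (analyticAt_ringInverse_powerSum hM hGb hG0)

theorem quotientSum_zero_apply (hG0 : ∀ t, G 0 t ≠ 0) (t : Icc (0 : ℝ) T) :
    quotientSum F G 0 t = F 0 t / G 0 t := by
  rw [quotientSum, powerSum_zero, powerSum_zero, ContinuousMap.mul_apply,
    ringInverse_apply ((ContinuousMap.isUnit_iff_forall_ne_zero _).mpr hG0), div_eq_mul_inv]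

theorem mul_quotientSum_apply (hM : 0 < M) (hFb : ∀ n, ‖F n‖ ≤ C * M ^ n)
    (hGb : ∀ n, ‖G n‖ ≤ C * M ^ n) {u : C(Icc (0 : ℝ) T, ℝ)} (hu : ‖u‖ < (M : ℝ)⁻¹)
    (hunit : IsUnit (powerSum G u)) (t : Icc (0 : ℝ) T) :
    (∑' j, u t ^ j * G j t) ≠ 0 ∧ (u * quotientSum F G u) t =
      (∑' j, u t ^ (j + 1) * F j t) / ∑' j, u t ^ j * G j t := by
  have hg := (powerSum_apply hM hGb hu t).tsum_eq
  have hf := ((powerSum_apply hM hFb hu t).mul_left (u t)).tsum_eq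
  refine ⟨?_, ?_⟩
  · rw [hg]
    exact (ContinuousMap.isUnit_iff_forall_ne_zero _).mp hunit t
  · rw [hg, ContinuousMap.mul_apply, quotientSum, ContinuousMap.mul_apply,
      ringInverse_apply hunit, ← mul_assoc, ← hf, div_eq_mul_inv]
    congr 2
    ext j
    ring

/-- An analytic map of the algebra is locally Lipschitz in the sup norm; restricting it to constant
functions gives a constant uniform in `t`. -/
theorem exists_lipschitzOnWith_quotient (hM : 0 < M) (hFb : ∀ n, ‖F n‖ ≤ C * M ^ n)
    (hGb : ∀ n, ‖G n‖ ≤ C * M ^ n) (hG0 : ∀ t, G 0 t ≠ 0) :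
    ∃ ε > 0, ∃ K : NNReal, ∀ t : Icc (0 : ℝ) T, LipschitzOnWith K
      (fun x : ℝ => (∑' j, x ^ (j + 1) * F j t) / ∑' j, x ^ j * G j t) (Ioo (-ε) ε) := by
  have hS : AnalyticAt ℝ (fun u => u * quotientSum F G u) 0 :=
    analyticAt_id.mul (analyticAt_quotientSum hM hFb hGb hG0)
  obtain ⟨K, s, hs, hK⟩ := hS.contDiffAt.exists_lipschitzOnWith
  obtain ⟨ε, hε, hεs⟩ := Metric.mem_nhds_iff.mp
    (inter_mem hs (eventually_isUnit_powerSum hM hGb hG0))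
  refine ⟨ε, hε, K, fun t => LipschitzOnWith.of_dist_le_mul fun x hx y hy => ?_⟩
  have hmem : ∀ x ∈ Ioo (-ε) ε, ContinuousMap.const (Icc (0 : ℝ) T) x ∈
      s ∩ {u | ‖u‖ < (M : ℝ)⁻¹ ∧ IsUnit (powerSum G u)} := by
    intro x hx
    refine hεs (mem_ball_zero_iff.mpr ?_)
    exact ((ContinuousMap.norm_le _ (abs_nonneg x)).mpr fun _ => le_rfl).trans_lt (abs_lt.mpr hx)
  have hval : ∀ x ∈ Ioo (-ε) ε, (∑' j, x ^ (j + 1) * F j t) / (∑' j, x ^ j * G j t) =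
      (ContinuousMap.const (Icc (0 : ℝ) T) x * quotientSum F G (ContinuousMap.const _ x)) t :=
    fun x hx => ((mul_quotientSum_apply hM hFb hGb (hmem x hx).2.1 (hmem x hx).2.2 t).2).symm
  rw [hval x hx, hval y hy]
  refine (ContinuousMap.dist_apply_le_dist t).trans ((hK.dist_le_mul _ (hmem x hx).1 _
    (hmem y hy).1).trans ?_)
  gcongr
  exact (ContinuousMap.dist_le dist_nonneg).mpr fun _ => le_rfl

theorem exists_analytic_ode_solution (hT : 0 ≤ T) (hM : 0 < M) (hFb : ∀ n, ‖F n‖ ≤ C * M ^ n)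
    (hGb : ∀ n, ‖G n‖ ≤ C * M ^ n) (hG0 : ∀ t, G 0 t ≠ 0) :
    ∃ (u : ℝ → C(Icc (0 : ℝ) T, ℝ)) (a : C(Icc (0 : ℝ) T, ℝ)), AnalyticAt ℝ u 0 ∧ u 0 = 0 ∧
      HasDerivAt u a 0 ∧
      (∀ t, a t = exp (∫ s in (0 : ℝ)..t, IccExtend hT (fun t => F 0 t / G 0 t) s)) ∧
      ∀ᶠ ρ in 𝓝 (0 : ℝ), u ρ ⟨0, le_rfl, hT⟩ = ρ ∧ ∀ t : Icc (0 : ℝ) T,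
        (∑' j, u ρ t ^ j * G j t) ≠ 0 ∧ HasDerivWithinAt (IccExtend hT (u ρ))
          ((∑' j, u ρ t ^ (j + 1) * F j t) / ∑' j, u ρ t ^ j * G j t) (Icc 0 T) t := by
  set f := quotientSum F G with hf
  set J := primitiveOp hT
  set a : C(Icc (0 : ℝ) T, ℝ) := ⟨fun t => exp (J (f 0) t), by fun_prop⟩ with ha
  set b : C(Icc (0 : ℝ) T, ℝ) := ⟨fun t => exp (-J (f 0) t), by fun_prop⟩ with hb
  have hab : ∀ t, a t * b t = 1 := fun t => by
    simp only [ha, hb, ContinuousMap.coe_mk]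
    rw [← exp_add, add_neg_cancel, exp_zero]
  have hfa : AnalyticAt ℝ f 0 := analyticAt_quotientSum hM hFb hGb hG0
  have hda : ∀ t : Icc (0 : ℝ) T, HasDerivWithinAt (IccExtend hT a) (f 0 t * a t) (Icc 0 T) t := by
    intro t
    have h1 := (hasDerivWithinAt_primitiveOp hT (f 0) t).exp
    rw [IccExtend_val, mul_comm] at h1
    exact h1
  obtain ⟨u, hua, hu0, hud, hu⟩ := exists_analytic_solution hfa J a b
  refine ⟨u, a, hua, hu0, hud, fun t => ?_, ?_⟩
  · simp only [ha, ContinuousMap.coe_mk]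
    congr 1
    change (∫ s in (0 : ℝ)..t, IccExtend hT (f 0) s) = _
    rw [show ⇑(f 0) = fun t => F 0 t / G 0 t from funext (quotientSum_zero_apply hG0)]
  have hu0' : Tendsto u (𝓝 0) (𝓝 0) := by simpa [hu0] using hua.continuousAt.tendsto
  filter_upwards [hu, hu0'.eventually (eventually_isUnit_powerSum hM hGb hG0)] with ρ hρ hρ2
  refine ⟨?_, fun t => ?_⟩
  · have h1 := congrArg (fun g : C(Icc (0 : ℝ) T, ℝ) => g ⟨0, le_rfl, hT⟩) hρ
    have h2 : ∀ g, J g ⟨0, le_rfl, hT⟩ = 0 := fun g => intervalIntegral.integral_same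
    have h3 : a ⟨0, le_rfl, hT⟩ = 1 := by
      simp only [ha, ContinuousMap.coe_mk, h2, exp_zero]
    simpa [h2, h3] using h1
  · obtain ⟨hne, hval⟩ := mul_quotientSum_apply hM hFb hGb hρ2.1 hρ2.2 t
    refine ⟨hne, ?_⟩
    rw [← hval]
    -- Differentiating `u = ρ a + a J(b u (f(u) - f(0)))` with `a' = f(0) a` and `a b = 1` gives
    -- back `u' = u f(u)`.
    have h1 := ((hda t).const_smul ρ).add
      ((hda t).mul (hasDerivWithinAt_primitiveOp hT (b * u ρ * (f (u ρ) - f 0)) t))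
    have h2 : IccExtend hT (u ρ) = (ρ • IccExtend hT a) +
        IccExtend hT a * IccExtend hT (J (b * u ρ * (f (u ρ) - f 0))) := by
      conv_lhs => rw [hρ]
      rfl
    have h3 := congrArg (fun g : C(Icc (0 : ℝ) T, ℝ) => g t) hρ
    rw [h2]
    convert! h1 using 1
    simp only [IccExtend_val, ContinuousMap.mul_apply, ContinuousMap.add_apply,
      ContinuousMap.smul_apply, ContinuousMap.sub_apply, smul_eq_mul] at h3 ⊢
    linear_combination (f 0 t) * h3 + (- u ρ t * (f (u ρ) t - f 0 t)) * hab t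

end Interval

/-! ### Bounds and convergence for the polar coefficients. -/

theorem continuous_polarF (p q : ℕ) (P Q : ℝ × ℝ → ℝ) (j : ℕ) : Continuous (polarF p q P Q j) := by
  have hP := continuous_qhPart p q P (p + j)
  have hQ := continuous_qhPart p q Q (q + j)
  unfold polarF
  fun_prop

theorem continuous_polarG (p q : ℕ) (P Q : ℝ × ℝ → ℝ) (j : ℕ) : Continuous (polarG p q P Q j) := by
  have hP := continuous_qhPart p q P (p + j)
  have hQ := continuous_qhPart p q Q (q + j)
  unfold polarG
  fun_prop

theorem continuous_polarD_mul_qhPart (p q : ℕ) (K : ℝ × ℝ → ℝ) (j : ℕ) :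
    Continuous fun φ => polarD p q φ * qhPart p q K j (cos φ, sin φ) := by
  have hK := continuous_qhPart p q K j
  unfold polarD
  fun_prop

theorem exists_abs_qhPart_cos_sin_le {f : ℝ × ℝ → ℝ} (hf : AnalyticAt ℝ f 0) {p q : ℕ}
    (hp : 0 < p) (hq : 0 < q) (m : ℕ) : ∃ C M : ℝ, 0 < C ∧ 1 ≤ M ∧ ∀ j φ,
      |qhPart p q f (m + j) (cos φ, sin φ)| ≤ C * M ^ j := by
  obtain ⟨C, M, hC, hM, h⟩ := exists_abs_qhPart_le hf hp hq
  refine ⟨C * M ^ m, M, by positivity, hM, fun j φ => ?_⟩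
  refine (h (m + j) _ _ (abs_cos_le_one φ) (abs_sin_le_one φ)).trans_eq ?_
  ring

theorem exists_polar_coeff_bound {p q : ℕ} {P Q K : ℝ × ℝ → ℝ} (hp : 0 < p) (hq : 0 < q)
    (hP : AnalyticAt ℝ P 0) (hQ : AnalyticAt ℝ Q 0) (hK : AnalyticAt ℝ K 0) (r rbar : ℕ) :
    ∃ (C : ℝ) (M : NNReal), 0 ≤ C ∧ 0 < M ∧ ∀ j φ, |polarF p q P Q (r + j) φ| ≤ C * M ^ j ∧
      |polarG p q P Q (r + j) φ| ≤ C * M ^ j ∧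
      |polarD p q φ * qhPart p q K (rbar + j) (cos φ, sin φ)| ≤ C * M ^ j := by
  obtain ⟨C₁, M₁, hC₁, hM₁, h₁⟩ := exists_abs_qhPart_cos_sin_le hP hp hq (p + r)
  obtain ⟨C₂, M₂, hC₂, hM₂, h₂⟩ := exists_abs_qhPart_cos_sin_le hQ hp hq (q + r)
  obtain ⟨C₃, M₃, hC₃, hM₃, h₃⟩ := exists_abs_qhPart_cos_sin_le hK hp hq rbar
  set C := C₁ + C₂ + C₃
  set M := M₁ + M₂ + M₃
  have hM0 : 0 ≤ M := by positivity
  have hle : ∀ C' M' : ℝ, 0 < C' → 1 ≤ M' → C' ≤ C → M' ≤ M → ∀ j : ℕ,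
      C' * M' ^ j ≤ C * M ^ j := fun C' M' h1 h2 h3 h4 j => by gcongr
  have b₁ : ∀ j φ, |qhPart p q P (p + (r + j)) (cos φ, sin φ)| ≤ C * M ^ j := fun j φ => by
    rw [← add_assoc]
    exact (h₁ j φ).trans (hle _ _ hC₁ hM₁ (by simp only [C]; linarith) (by simp only [M]; linarith) j)
  have b₂ : ∀ j φ, |qhPart p q Q (q + (r + j)) (cos φ, sin φ)| ≤ C * M ^ j := fun j φ => by
    rw [← add_assoc]
    exact (h₂ j φ).trans (hle _ _ hC₂ hM₂ (by simp only [C]; linarith) (by simp only [M]; linarith) j)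
  have b₃ : ∀ j φ, |qhPart p q K (rbar + j) (cos φ, sin φ)| ≤ C * M ^ j := fun j φ =>
    (h₃ j φ).trans (hle _ _ hC₃ hM₃ (by simp only [C]; linarith) (by simp only [M]; linarith) j)
  have hp0 : (0 : ℝ) ≤ p := Nat.cast_nonneg p
  have hq0 : (0 : ℝ) ≤ q := Nat.cast_nonneg q
  have hCM : ∀ j : ℕ, 0 ≤ C * M ^ j := fun j => by positivity
  refine ⟨(2 + p + q) * C, ⟨M, hM0⟩, by positivity, ?_, fun j φ => ⟨?_, ?_, ?_⟩⟩
  · change 0 < M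
    positivity
  · change _ ≤ (2 + p + q) * C * M ^ j
    have hc := abs_cos_le_one φ
    have hs := abs_sin_le_one φ
    calc |polarF p q P Q (r + j) φ| ≤ C * M ^ j * 1 + C * M ^ j * 1 := by
          refine (abs_add_le _ _).trans ?_
          rw [abs_mul, abs_mul]
          gcongr
          exacts [b₁ j φ, b₂ j φ]
      _ ≤ _ := by nlinarith [hCM j, mul_nonneg hp0 (hCM j), mul_nonneg hq0 (hCM j)]
  · change _ ≤ (2 + p + q) * C * M ^ j
    have hc := abs_cos_le_one φ
    have hs := abs_sin_le_one φ
    calc |polarG p q P Q (r + j) φ| ≤ p * (C * M ^ j) * 1 + q * (C * M ^ j) * 1 := by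
          refine (abs_sub _ _).trans ?_
          rw [abs_mul, abs_mul, abs_mul, abs_mul, abs_of_nonneg hp0, abs_of_nonneg hq0]
          have := hCM j
          gcongr
          exacts [b₂ j φ, b₁ j φ]
      _ ≤ _ := by nlinarith [hCM j, mul_nonneg hp0 (hCM j), mul_nonneg hq0 (hCM j)]
  · change _ ≤ (2 + p + q) * C * M ^ j
    have hD : |polarD p q φ| ≤ p + q := by
      have h1 := cos_sq_le_one φ
      have h2 := sin_sq_le_one φ
      rw [polarD, abs_of_nonneg (by positivity)]
      nlinarith [mul_nonneg hp0 (sub_nonneg.mpr h1), mul_nonneg hq0 (sub_nonneg.mpr h2)]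
    rw [abs_mul]
    calc _ ≤ (p + q) * (C * M ^ j) := by
          gcongr
          exact b₃ j φ
      _ ≤ _ := by nlinarith [hCM j]

/-- The restriction of a continuous function to `[0, T]`. -/
def restrictIcc (T : ℝ) (f : ℝ → ℝ) (hf : Continuous f) : C(Icc (0 : ℝ) T, ℝ) :=
  ⟨fun t => f t, hf.comp continuous_subtype_val⟩

theorem norm_restrictIcc_le {T : ℝ} {f : ℝ → ℝ} (hf : Continuous f) {C : ℝ} (hC : 0 ≤ C)
    (h : ∀ t, |f t| ≤ C) : ‖restrictIcc T f hf‖ ≤ C :=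
  (ContinuousMap.norm_le _ hC).mpr fun t => h t

theorem exists_hasSum_cofactor {p q rbar : ℕ} {K : ℝ × ℝ → ℝ} (hp : 0 < p) (hq : 0 < q)
    (hK : AnalyticAt ℝ K 0) (hrbar : ∀ j < rbar, ∀ z, qhPart p q K j z = 0) :
    ∃ ε > 0, ∀ ρ, 0 < ρ → ρ < ε → ∀ φ,
      HasSum (fun j => ρ ^ (rbar + j) * qhPart p q K (rbar + j) (cos φ, sin φ))
        (K (ρ ^ p * cos φ, ρ ^ q * sin φ)) := by
  obtain ⟨ε, hε, h⟩ := Metric.eventually_nhds_iff.mp (eventually_hasSum_qhPart hK hp hq)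
  -- For `ρ ≤ 1` both `ρ ^ p` and `ρ ^ q` are at most `ρ`, so the series converges for every `φ` at
  -- once.
  refine ⟨min ε 1, lt_min hε one_pos, fun ρ hρ hρε φ => ?_⟩
  have hρ1 : ρ ≤ 1 := (hρε.trans_le (min_le_right _ _)).le
  have hz : dist ((ρ ^ p * cos φ, ρ ^ q * sin φ) : ℝ × ℝ) 0 < ε := by
    rw [dist_zero_right, Prod.norm_def]
    refine (max_le ?_ ?_).trans_lt (hρε.trans_le (min_le_left _ _))
    · rw [norm_mul, norm_pow, Real.norm_of_nonneg hρ.le]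
      exact (mul_le_of_le_one_right (by positivity) (abs_cos_le_one φ)).trans
        (pow_le_of_le_one hρ.le hρ1 hp.ne')
    · rw [norm_mul, norm_pow, Real.norm_of_nonneg hρ.le]
      exact (mul_le_of_le_one_right (by positivity) (abs_sin_le_one φ)).trans
        (pow_le_of_le_one hρ.le hρ1 hq.ne')
  have h1 := h hz
  simp only [qhPart_weighted] at h1
  rw [← hasSum_nat_add_iff' rbar, Finset.sum_eq_zero (fun j hj => by
    rw [hrbar j (Finset.mem_range.mp hj), mul_zero]), sub_zero] at h1
  simpa only [add_comm] using h1

/-! ### The expansion of the integral of the cofactor. -/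

section Interval

variable {T : ℝ} {H G : ℕ → C(Icc (0 : ℝ) T, ℝ)} {C : ℝ} {M : NNReal}

/-- The quotient rule in the algebra; this is the source of the second summand of `β (rbar - r +
1)`. -/
theorem hasDerivAt_quotientSum_comp (hM : 0 < M) (hHb : ∀ n, ‖H n‖ ≤ C * M ^ n)
    (hGb : ∀ n, ‖G n‖ ≤ C * M ^ n) (hG0 : ∀ t, G 0 t ≠ 0) {u : ℝ → C(Icc (0 : ℝ) T, ℝ)}
    {a : C(Icc (0 : ℝ) T, ℝ)} (hu0 : u 0 = 0) (hu : HasDerivAt u a 0) :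
    ∃ d, HasDerivAt (fun ρ => quotientSum H G (u ρ)) d 0 ∧
      ∀ t, d t = a t * (H 1 t * G 0 t - H 0 t * G 1 t) / G 0 t ^ 2 := by
  obtain ⟨y, hy⟩ := (ContinuousMap.isUnit_iff_forall_ne_zero _).mpr hG0
  have h1 := (hasFDerivAt_powerSum hM hHb).comp_hasDerivAt_of_eq (0 : ℝ) hu hu0.symm
  have h2 := (hasFDerivAt_powerSum hM hGb).comp_hasDerivAt_of_eq (0 : ℝ) hu hu0.symm
  have h3 := (hasFDerivAt_ringInverse (𝕜 := ℝ) y).comp_hasDerivAt_of_eq (0 : ℝ) h2 (by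
    simp [hu0, powerSum_zero, hy])
  refine ⟨_, h1.mul h3, fun t => ?_⟩
  have hyinv : ∀ t, (↑y⁻¹ : C(Icc (0 : ℝ) T, ℝ)) t = (G 0 t)⁻¹ := fun t => by
    rw [← Ring.inverse_unit, hy,
      ringInverse_apply ((ContinuousMap.isUnit_iff_forall_ne_zero _).mpr hG0)]
  have := hG0 t
  simp only [Function.comp_apply, hu0, powerSum_zero, ← hy, Ring.inverse_unit]
  simp [hyinv, hy]
  field_simp
  ring

end Interval

theorem polar_expansion {p q r rbar : ℕ} {P Q K : ℝ × ℝ → ℝ} (hp : 0 < p) (hq : 0 < q)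
    (hP : AnalyticAt ℝ P 0) (hQ : AnalyticAt ℝ Q 0) (hK : AnalyticAt ℝ K 0)
    (hG : ∀ φ, polarG p q P Q r φ ≠ 0) (hrbar : ∀ j < rbar, ∀ z, qhPart p q K j z = 0)
    (hr : r ≤ rbar) :
    ∃ δ : ℝ, 0 < δ ∧ ∃ (ρ : ℝ → ℝ → ℝ) (a : ℕ → ℝ → ℝ) (β : ℕ → ℝ),
      (∀ ρ₀ ∈ Ioo 0 δ, IsPolarSolution p q P Q r ρ₀ (fun φ => ρ φ ρ₀) ∧
        ∀ v : ℝ → ℝ, IsPolarSolution p q P Q r ρ₀ v →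
          EqOn v (fun φ => ρ φ ρ₀) (Icc 0 (2 * π))) ∧
      (∀ ρ₀ ∈ Ioo 0 δ, ∀ φ ∈ Icc 0 (2 * π),
        HasSum (fun i : ℕ => a (i + 1) φ * ρ₀ ^ (i + 1)) (ρ φ ρ₀)) ∧
      (∀ ρ₀ ∈ Ioo 0 δ,
        ContinuousOn (fun φ => polarCofactor p q P Q r K φ (ρ φ ρ₀)) (Icc 0 (2 * π)) ∧
        HasSum (fun i : ℕ => β (rbar - r + i) * ρ₀ ^ (rbar - r + i))
          (∫ φ in (0 : ℝ)..(2 * π), polarCofactor p q P Q r K φ (ρ φ ρ₀))) ∧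
      (∀ φ ∈ Icc 0 (2 * π),
        a 1 φ = exp (∫ t in (0 : ℝ)..φ, polarF p q P Q r t / polarG p q P Q r t)) ∧
      ContinuousOn (a 2) (Icc 0 (2 * π)) ∧
      β (rbar - r) = ∫ φ in (0 : ℝ)..(2 * π),
        polarD p q φ * a 1 φ ^ (rbar - r) * qhPart p q K rbar (cos φ, sin φ) /
          polarG p q P Q r φ ∧
      β (rbar - r + 1) = ∫ φ in (0 : ℝ)..(2 * π),
        polarD p q φ *
          (((rbar : ℝ) - (r : ℝ)) * a 1 φ ^ ((rbar : ℤ) - (r : ℤ) - 1) * a 2 φ *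
              qhPart p q K rbar (cos φ, sin φ) / polarG p q P Q r φ +
            a 1 φ ^ (rbar - r + 1) *
              (qhPart p q K (rbar + 1) (cos φ, sin φ) * polarG p q P Q r φ -
                qhPart p q K rbar (cos φ, sin φ) * polarG p q P Q (r + 1) φ) /
              polarG p q P Q r φ ^ 2) := by
  have hT : (0 : ℝ) ≤ 2 * π := by positivity
  obtain ⟨m, rfl⟩ := Nat.exists_eq_add_of_le hr
  obtain ⟨C, M, hC, hM, hb⟩ := exists_polar_coeff_bound hp hq hP hQ hK r (r + m)
  set F : ℕ → C(Icc (0 : ℝ) (2 * π), ℝ) := fun j =>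
    restrictIcc _ (polarF p q P Q (r + j)) (continuous_polarF _ _ _ _ _)
  set G : ℕ → C(Icc (0 : ℝ) (2 * π), ℝ) := fun j =>
    restrictIcc _ (polarG p q P Q (r + j)) (continuous_polarG _ _ _ _ _)
  set H : ℕ → C(Icc (0 : ℝ) (2 * π), ℝ) := fun j =>
    restrictIcc _ (fun φ => polarD p q φ * qhPart p q K (r + m + j) (cos φ, sin φ))
      (continuous_polarD_mul_qhPart _ _ _ _)
  have hFb : ∀ n, ‖F n‖ ≤ C * M ^ n := fun n =>
    norm_restrictIcc_le _ (by positivity) fun t => (hb n t).1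
  have hGb : ∀ n, ‖G n‖ ≤ C * M ^ n := fun n =>
    norm_restrictIcc_le _ (by positivity) fun t => (hb n t).2.1
  have hHb : ∀ n, ‖H n‖ ≤ C * M ^ n := fun n =>
    norm_restrictIcc_le _ (by positivity) fun t => (hb n t).2.2
  have hG0 : ∀ t, G 0 t ≠ 0 := fun t => hG t
  obtain ⟨u, a, hua, hu0, hud, haf, hsol⟩ := exists_analytic_ode_solution hT hM hFb hGb hG0
  obtain ⟨ε, hε, L, hL⟩ := exists_lipschitzOnWith_quotient hM hFb hGb hG0
  obtain ⟨κ, hκ, hKsum⟩ := exists_hasSum_cofactor hp hq hK hrbar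
  -- the blow-up `v = u / ρ₀` of the solution, and the coefficients of its expansion
  set v := dslope u 0 with hv
  have huv : ∀ x, u x = x • v x := fun x => by
    have := sub_smul_dslope u 0 x
    rw [sub_zero, hu0, sub_zero] at this
    exact this.symm
  obtain ⟨s, hs⟩ := id hua
  have hs1 : s.coeff 1 = a := hs.hasDerivAt.unique hud
  have hs0 : s.coeff 0 = 0 := by
    have := hs.coeff_zero 1
    rw [hu0] at this
    exact this
  have hvs : HasFPowerSeriesAt v s.fslope 0 := hs.has_fpower_series_dslope_fslope
  have hv0 : v 0 = a := by rw [hv, dslope_same, hud.deriv]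
  have hvd : HasDerivAt v (s.coeff 2) 0 := by
    have := hvs.hasDerivAt
    rwa [show s.fslope 1 (fun _ => 1) = s.coeff 2 from FormalMultilinearSeries.coeff_fslope] at this
  have hapos : ∀ t, 0 < a t := fun t => by rw [haf]; exact exp_pos _
  have hvpos : ∀ᶠ x in 𝓝 (0 : ℝ), ∀ t, 0 < v x t := by
    -- Positivity on a compact interval is an open condition, so it passes from `v 0 = a` to nearby
    -- `v x`, and then to `u x = x • v x` for `x > 0`.
    have h1 : {w : C(Icc (0 : ℝ) (2 * π), ℝ) | MapsTo w univ (Ioi 0)} ∈ 𝓝 (v 0) := by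
      refine (ContinuousMap.isOpen_setOfPred_mapsTo isCompact_univ isOpen_Ioi).mem_nhds ?_
      rw [hv0]
      exact fun t _ => hapos t
    filter_upwards [hvs.continuousAt h1] with x hx t
    exact hx (mem_univ t)
  -- the reduced cofactor and its integral
  set w : ℝ → C(Icc (0 : ℝ) (2 * π), ℝ) := fun x => v x ^ m * quotientSum H G (u x) with hw
  set Λ : C(Icc (0 : ℝ) (2 * π), ℝ) →L[ℝ] ℝ :=
    (ContinuousMap.evalCLM ℝ (⟨2 * π, hT, le_rfl⟩ : Icc (0 : ℝ) (2 * π))).comp (primitiveOp hT)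
  have hΛe : ∀ g, Λ g = ∫ φ in (0 : ℝ)..(2 * π), IccExtend hT g φ := fun g => rfl
  have hqa : AnalyticAt ℝ (fun x => quotientSum H G (u x)) 0 := by
    refine AnalyticAt.comp (g := quotientSum H G) ?_ hua
    rw [hu0]
    exact analyticAt_quotientSum hM hHb hGb hG0
  have hwa : AnalyticAt ℝ w 0 := (hvs.analyticAt.pow m).mul hqa
  have hga : AnalyticAt ℝ (fun x => Λ (w x)) 0 := (Λ.analyticAt _).comp hwa
  obtain ⟨g, hg⟩ := hga
  obtain ⟨d, hd, hdt⟩ := hasDerivAt_quotientSum_comp hM hHb hGb hG0 hu0 hud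
  have hwd := (hvd.fun_pow m).mul hd
  have hu_tendsto : Tendsto u (𝓝 0) (𝓝 0) := by simpa [hu0] using hua.continuousAt.tendsto
  have hsmall : ∀ c : ℝ, 0 < c → ∀ᶠ x in 𝓝 (0 : ℝ), ‖u x‖ < c := fun c hc =>
    (((continuous_norm.tendsto' _ 0 norm_zero).comp hu_tendsto).eventually (gt_mem_nhds hc))
  have hev := (hsol.and (hsmall ε hε)).and ((hsmall κ hκ).and (hvpos.and
    ((hasFPowerSeriesAt_iff.mp hs).and ((hasFPowerSeriesAt_iff.mp hg).and
      (hu_tendsto.eventually (eventually_isUnit_powerSum hM hGb hG0))))))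
  obtain ⟨δ, hδ, hall⟩ := Metric.eventually_nhds_iff.mp hev
  have hall' : ∀ x ∈ Ioo 0 δ, _ := fun x hx =>
    hall (y := x) (by rw [dist_zero_right, Real.norm_of_nonneg hx.1.le]; exact hx.2)
  have huabs : ∀ x t, |u x t| ≤ ‖u x‖ := fun x t => (u x).norm_coe_le_norm t
  -- The numerator carries `u ^ (r + m)` and the denominator `u ^ r`; what remains is `u ^ m = x ^ m
  -- * v ^ m`.
  have hcof : ∀ x ∈ Ioo 0 δ, ∀ t : Icc (0 : ℝ) (2 * π),
      polarCofactor p q P Q r K t (u x t) = x ^ m * w x t := by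
    intro x hx t
    obtain ⟨-, hκx, hvx, -, -, hnx, hux⟩ := hall' x hx
    have hut : 0 < u x t := by
      rw [huv, ContinuousMap.smul_apply, smul_eq_mul]
      exact mul_pos hx.1 (hvx t)
    have h1 := (hKsum (u x t) hut ((le_abs_self _).trans_lt ((huabs x t).trans_lt hκx)) t).mul_left
      (polarD p q t)
    have h2 := (powerSum_apply hM hHb hnx t).mul_left (u x t ^ (r + m))
    have h3 : polarD p q t * K (u x t ^ p * cos t, u x t ^ q * sin t) =
        u x t ^ (r + m) * powerSum H (u x) t := by
      refine h1.unique ?_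
      convert! h2 using 1
      ext j
      change _ = u x t ^ (r + m) * (u x t ^ j * (polarD p q t * qhPart p q K (r + m + j)
        (cos t, sin t)))
      ring
    have h4 : polarTheta p q P Q r t (u x t) = powerSum G (u x) t :=
      (powerSum_apply hM hGb hnx t).tsum_eq
    have h5 : powerSum G (u x) t ≠ 0 := (ContinuousMap.isUnit_iff_forall_ne_zero _).mp hux t
    rw [polarCofactor, h3, h4, hw]
    simp only [ContinuousMap.mul_apply, ContinuousMap.pow_apply, quotientSum,
      ringInverse_apply hux]
    have h6 : u x t = x * v x t := by rw [huv]; rfl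
    have h7 : x ^ m * v x t ^ m = u x t ^ m := by rw [h6, mul_pow]
    rw [← mul_assoc, h7]
    field_simp
    ring
  have hcofE : ∀ x ∈ Ioo 0 δ, ∀ φ ∈ Icc 0 (2 * π),
      polarCofactor p q P Q r K φ (IccExtend hT (u x) φ) = x ^ m * IccExtend hT (w x) φ := by
    intro x hx φ hφ
    rw [IccExtend_of_mem _ _ hφ, IccExtend_of_mem _ _ hφ]
    exact hcof x hx ⟨φ, hφ⟩
  have huIcc : uIcc 0 (2 * π) = Icc 0 (2 * π) := uIcc_of_le hT
  -- Only the `β n` with `n ≥ m` enter the claims, so the truncated `n - m` is harmless below `m`.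
  refine ⟨δ, hδ, fun φ x => IccExtend hT (u x) φ, fun i => IccExtend hT (s.coeff i),
    fun n => g.coeff (n - m), ?_, ?_, ?_, ?_, ?_, ?_, ?_⟩
  · intro x hx
    obtain ⟨⟨⟨hinit, hode⟩, hεx⟩, -, hvx, -⟩ := hall' x hx
    have hinit' : IccExtend hT (u x) 0 = x := by
      rw [IccExtend_of_mem _ _ ⟨le_rfl, hT⟩]
      exact hinit
    have hsolx : IsPolarSolution p q P Q r x (IccExtend hT (u x)) := by
      refine ⟨hinit', fun φ hφ => ?_⟩
      rw [IccExtend_of_mem _ _ hφ]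
      refine ⟨?_, hode ⟨φ, hφ⟩⟩
      rw [huv, ContinuousMap.smul_apply, smul_eq_mul]
      exact mul_pos hx.1 (hvx _)
    refine ⟨hsolx, fun y hy => ?_⟩
    refine eqOn_Icc_of_lipschitzOn_near_zero (ε := ε) (K := L)
      (v := fun φ ρ => polarR p q P Q r φ ρ / polarTheta p q P Q r φ ρ)
      (fun φ hφ => hL ⟨φ, hφ⟩) (fun φ hφ => (hsolx.2 φ hφ).2.2) (fun φ hφ => (hy.2 φ hφ).2.2)
      (fun φ _ => abs_lt.mp ((huabs x _).trans_lt hεx)) ?_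
    exact hy.1.trans hinit'.symm
  · intro x hx φ hφ
    obtain ⟨-, -, -, hsx, -⟩ := hall' x hx
    rw [zero_add, ← hasSum_nat_add_iff' 1] at hsx
    have h1 := hsx.map (ContinuousMap.evalCLM ℝ (projIcc 0 (2 * π) hT φ))
      (ContinuousMap.evalCLM ℝ (projIcc 0 (2 * π) hT φ)).continuous
    convert! h1 using 1
    · ext i
      simp [IccExtend, mul_comm]
    · simp [IccExtend, hs0]
  · intro x hx
    obtain ⟨-, -, -, -, hgx, -⟩ := hall' x hx
    refine ⟨?_, ?_⟩
    · have h1 : Continuous fun φ => x ^ m * IccExtend hT (w x) φ :=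
        continuous_const.mul (w x).continuous.Icc_extend'
      exact h1.continuousOn.congr (hcofE x hx)
    · rw [intervalIntegral.integral_congr (g := fun φ => x ^ m * IccExtend hT (w x) φ)
        (fun φ hφ => hcofE x hx φ (huIcc ▸ hφ)), intervalIntegral.integral_const_mul, ← hΛe]
      rw [zero_add] at hgx
      convert! hgx.mul_left (x ^ m) using 1
      ext i
      simp only [Nat.add_sub_cancel_left, smul_eq_mul, pow_add]
      ring
  · intro φ hφ
    change IccExtend hT (s.coeff 1) φ = _
    rw [IccExtend_of_mem _ _ hφ, hs1, haf]
    congr 1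
    refine intervalIntegral.integral_congr fun t ht => ?_
    have ht' : t ∈ Icc 0 (2 * π) := by
      rw [uIcc_of_le hφ.1] at ht
      exact ⟨ht.1, ht.2.trans hφ.2⟩
    rw [IccExtend_of_mem _ _ ht']
    rfl
  · exact (s.coeff 2).continuous.Icc_extend'.continuousOn
  · have h1 : g.coeff 0 = Λ (w 0) := hg.coeff_zero 1
    simp only [Nat.add_sub_cancel_left, Nat.sub_self]
    rw [h1, hΛe]
    refine intervalIntegral.integral_congr fun φ hφ => ?_
    rw [huIcc] at hφ
    simp only [IccExtend_of_mem _ _ hφ, hs1, hw, hv0, hu0, ContinuousMap.mul_apply,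
      ContinuousMap.pow_apply, quotientSum_zero_apply hG0]
    change _ * (polarD p q φ * qhPart p q K (r + m) (cos φ, sin φ) / polarG p q P Q r φ) = _
    ring
  · have h1 : g.coeff 1 = _ := hg.hasDerivAt.unique (Λ.hasFDerivAt.comp_hasDerivAt (0 : ℝ) hwd)
    simp only [Nat.add_sub_cancel_left, show m + 1 - m = 1 by omega]
    rw [h1, hΛe]
    refine intervalIntegral.integral_congr fun φ hφ => ?_
    rw [huIcc] at hφ
    have hGφ := hG φ
    have hnat : ∀ t, ((m : C(Icc (0 : ℝ) (2 * π), ℝ)) t) = (m : ℝ) := fun t => by simp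
    -- For `m = 0` the integer exponent is `-1` and the natural one is `0`; the factor `m` removes
    -- both.
    have hz : (m : ℝ) * a ⟨φ, hφ⟩ ^ (((r + m : ℕ) : ℤ) - (r : ℤ) - 1) =
        m * a ⟨φ, hφ⟩ ^ (m - 1) := by
      rcases Nat.eq_zero_or_pos m with rfl | hm
      · simp
      · rw [show ((r + m : ℕ) : ℤ) - (r : ℤ) - 1 = ((m - 1 : ℕ) : ℤ) by push_cast; omega,
          zpow_natCast]
    have hz' : ((r + m : ℕ) : ℝ) - (r : ℝ) = m := by push_cast; ring
    simp only [IccExtend_of_mem _ _ hφ, hs1, hv0, hu0, ContinuousMap.mul_apply,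
      ContinuousMap.pow_apply, ContinuousMap.add_apply, quotientSum_zero_apply hG0, hdt, hnat,
      hz', hz]
    change m * a ⟨φ, hφ⟩ ^ (m - 1) * s.coeff 2 ⟨φ, hφ⟩ *
      (polarD p q φ * qhPart p q K (r + m) (cos φ, sin φ) / polarG p q P Q r φ) +
      a ⟨φ, hφ⟩ ^ m * (a ⟨φ, hφ⟩ * ((polarD p q φ * qhPart p q K (r + m + 1) (cos φ, sin φ)) *
        polarG p q P Q r φ - (polarD p q φ * qhPart p q K (r + m) (cos φ, sin φ)) *
        polarG p q P Q (r + 1) φ) / polarG p q P Q r φ ^ 2) = _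
    ring

end

theorem mainTheorem5
    (p q r rbar : ℕ) (P Q F K : ℝ × ℝ → ℝ)
    -- an analytic vector field `P ∂ₓ + Q ∂ᵧ` in the class `Mo^{(p,q)}`, with leading degree `r`
    (hP : AnalyticAt ℝ P 0) (hQ : AnalyticAt ℝ Q 0) (hr : 1 ≤ r)
    (hMo : InMonodromicClass p q P Q r)
    -- an analytic invariant curve `F = 0` through the origin, with cofactor `K`
    (hF : AnalyticAt ℝ F 0) (hF0 : F 0 = 0) (hFne : ¬ (∀ᶠ z in 𝓝 (0 : ℝ × ℝ), F z = 0))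
    (hK : AnalyticAt ℝ K 0)
    (hinv : ∀ᶠ z in 𝓝 (0 : ℝ × ℝ), fderiv ℝ F z (P z, Q z) = K z * F z)
    -- the quasihomogeneous expansion of `K` is `K_{rbar} + ⋯`
    (hrbar : ∀ j < rbar, ∀ z, qhPart p q K j z = 0) :
    ((∃ z, qhPart p q K rbar z ≠ 0) → r ≤ rbar) ∧
    (r ≤ rbar →
      (∀ φ, polarG p q P Q r φ ≠ 0) ∧
      ∃ δ : ℝ, 0 < δ ∧ ∃ (ρ : ℝ → ℝ → ℝ) (a : ℕ → ℝ → ℝ) (β : ℕ → ℝ),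
        -- `ρ φ ρ₀` is the solution with initial condition `ρ 0 ρ₀ = ρ₀`
        (∀ ρ₀ ∈ Ioo 0 δ, IsPolarSolution p q P Q r ρ₀ (fun φ => ρ φ ρ₀) ∧
          ∀ v : ℝ → ℝ, IsPolarSolution p q P Q r ρ₀ v →
            EqOn v (fun φ => ρ φ ρ₀) (Icc 0 (2 * π))) ∧
        -- `ρ φ ρ₀ = ∑_{i ≥ 1} a i φ * ρ₀ ^ i`
        (∀ ρ₀ ∈ Ioo 0 δ, ∀ φ ∈ Icc 0 (2 * π),
          HasSum (fun i : ℕ => a (i + 1) φ * ρ₀ ^ (i + 1)) (ρ φ ρ₀)) ∧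
        -- the integral of the cofactor is not singular, and is `∑_{i ≥ rbar - r} β i * ρ₀ ^ i`
        (∀ ρ₀ ∈ Ioo 0 δ,
          ContinuousOn (fun φ => polarCofactor p q P Q r K φ (ρ φ ρ₀)) (Icc 0 (2 * π)) ∧
          HasSum (fun i : ℕ => β (rbar - r + i) * ρ₀ ^ (rbar - r + i))
            (∫ φ in (0 : ℝ)..(2 * π), polarCofactor p q P Q r K φ (ρ φ ρ₀))) ∧
        -- the function `a 1`, and the first two coefficients
        (∀ φ ∈ Icc 0 (2 * π),
          a 1 φ = exp (∫ t in (0 : ℝ)..φ, polarF p q P Q r t / polarG p q P Q r t)) ∧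
        ContinuousOn (a 2) (Icc 0 (2 * π)) ∧
        β (rbar - r) = ∫ φ in (0 : ℝ)..(2 * π),
          polarD p q φ * a 1 φ ^ (rbar - r) * qhPart p q K rbar (cos φ, sin φ) /
            polarG p q P Q r φ ∧
        β (rbar - r + 1) = ∫ φ in (0 : ℝ)..(2 * π),
          polarD p q φ *
            (((rbar : ℝ) - (r : ℝ)) * a 1 φ ^ ((rbar : ℤ) - (r : ℤ) - 1) * a 2 φ *
                qhPart p q K rbar (cos φ, sin φ) / polarG p q P Q r φ +
              a 1 φ ^ (rbar - r + 1) *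
                (qhPart p q K (rbar + 1) (cos φ, sin φ) * polarG p q P Q r φ -
                  qhPart p q K rbar (cos φ, sin φ) * polarG p q P Q (r + 1) φ) /
                polarG p q P Q r φ ^ 2)) := by
  obtain ⟨⟨hp, hq, -, -⟩, ⟨hP0, hQ0, -⟩, hmono⟩ := hMo
  refine ⟨leadingDegree_le_of_cofactor hp hq hP hQ hP0 hQ0 hF hFne hK hinv hrbar, fun hle => ?_⟩
  have hG := polarG_ne_zero_of_isMonodromic hp hq hmono
  exact ⟨hG, polar_expansion hp hq hP hQ hK hG hrbar hle⟩
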